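/- \textbf{Theorem 3.} A disjunctive identity (d-identity) of a group $G$ is a formula $(f_1=1)\vee\dots\vee(f_n=1)$, where $f_1,\dots,f_n$ are elements of the free group on countably many variables, which is true for all values of the variables in $G$; an equation $f=h$ stands for $fh^{-1}=1$. A set of d-identities of a group $H$ is a basis of d-identities of $H$ if every group satisfying all of them satisfies every d-identity of $H$. Write $a^b=b^{-1}ab$ and $a^{3b}=(a^3)^b$, let $a\in\langle b\rangle$ denote the formula $(a=1)\vee(a=b)\vee(a=b^2)\vee(a=b^3)$, and let $\theta(x_1,x_2,x_3)$ be $$\Big[\bigvee_{i\ne j} x_i\in\langle x_j\rangle\Big]\vee\Big[\bigvee_{\sigma\in S_3}x_{\sigma(1)}\in\langle x_{\sigma(2)}x_{\sigma(3)}\rangle\Big]\vee\Big[\bigvee_{\sigma\in S_3}x_{\sigma(1)}x_{\sigma(2)}\in\langle x_{\sigma(2)}x_{\sigma(3)}\rangle\Big],$$ where $i,j$ run over $1,2,3$. Then the following seven formulas form a basis of d-identities of the alternating group $A_6$: (4.1) $\displaystyle\bigvee_{0\le i<j\le 360}(x_i=x_j)$; (4.2) $(x^3=1)\vee(x^4=1)\vee(x^5=1)$;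 (4.3) $\displaystyle\Big[\bigvee_{i}x_i^{20}=1\Big]\vee\Big[\bigvee_{i<j}x_i=x_j\Big]\vee\Big[\bigvee_{i<j}(x_ix_j)^{20}=1\Big]\vee\Big[\bigvee_{i<j}(x_ix_j^2)^{20}=1\Big]$, where $i,j$ run over $1,\dots,9$; (4.4) $(x_1^{30}=1)\vee(x_2^{30}=1)\vee((x_1x_2)^{15}=1)\vee((x_1x_2^2)^{15}=1)\vee((x_1x_2^3)^{15}=1)$; (4.5) $\displaystyle\theta(x_1,x_2,x_3)\vee\Big[\bigvee_i x_i^{15}=1\Big]\vee\Big[\bigvee_{i\ne j}(x_ix_j)^{15}=1\Big]\vee\Big[\bigvee_{i\ne j}(x_ix_j^2)^{15}=1\Big]\vee\Big[\bigvee_{i\ne j}(x_ix_j^3)^{15}=1\Big]$, where $i,j$ run over $1,2,3$; (4.6) $(x_1^{12}=1)\vee(x_2^{30}=1)\vee((x_1x_1^{x_2})^{12}=1)\vee((x_1x_1^{3x_2})^{12}=1)\vee((x_1^2x_1^{x_2})^{12}=1)$; (4.7) $(x_1^{12}=1)\vee(x_2^{12}=1)\vee((x_1x_2)^{12}=1)\vee((x_1x_2^2)^{12}=1)\vee((x_1x_2^3)^{12}=1)\vee((x_1x_2^4)^{12}=1)$.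 Concretely: all seven formulas hold in $A_6$; every group satisfying them satisfies all d-identities of $A_6$; and every group satisfying them is isomorphic to a section (a quotient of a subgroup) of $A_6$. -/

import Mathlib

universe u v

/-- A disjunctive formula `∀ x₀ x₁ …, (f₁ = 1) ∨ ⋯ ∨ (fₙ = 1)`: the finite set of the words
`f₁, …, fₙ` in the free group on countably many variables. -/
abbrev DFormula : Type := Finset (FreeGroup ℕ)

namespace DFormula

/-- `δ` is a disjunctive identity of `G`: for all values in `G` of the variables, at least one
of the equations `f = 1` of `δ` holds. -/
def HoldsIn (δ : DFormula) (G : Type v) [Group G] : Prop :=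
  ∀ g : ℕ → G, ∃ f ∈ δ, FreeGroup.lift g f = 1

/-- The one-equation formula `f = 1`. -/
def isOne (f : FreeGroup ℕ) : DFormula := {f}

/-- The one-equation formula `f = h`, written as `f h⁻¹ = 1`. -/
def eqn (f h : FreeGroup ℕ) : DFormula := {f * h⁻¹}

/-- Finite disjunction `⋁_{i ∈ s} δ i`. -/
def bigOr {ι : Type} (s : Finset ι) (δ : ι → DFormula) : DFormula := s.biUnion δ

/-- The variable `x_i`. -/
def x (i : ℕ) : FreeGroup ℕ := FreeGroup.of i

/-- The conjugate `a ^ b = b⁻¹ a b`. -/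
def conj (a b : FreeGroup ℕ) : FreeGroup ℕ := b⁻¹ * a * b

/-- The pairs `(i, j)` of elements of `s` with `i < j`. -/
def ltPairs (s : Finset ℕ) : Finset (ℕ × ℕ) := (s ×ˢ s).filter fun p => p.1 < p.2

/-- The formula `a ∈ ⟨b⟩`, that is, `(a = 1) ∨ (a = b) ∨ (a = b²) ∨ (a = b³)`. -/
def inCyc (a b : FreeGroup ℕ) : DFormula :=
  isOne a ∪ eqn a b ∪ eqn a (b ^ 2) ∪ eqn a (b ^ 3)

/-- The formula `θ(y 0, y 1, y 2)`. -/
def theta (y : Fin 3 → FreeGroup ℕ) : DFormula :=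
  bigOr (Finset.univ : Finset (Fin 3)).offDiag (fun p => inCyc (y p.1) (y p.2))
  ∪ bigOr (Finset.univ : Finset (Equiv.Perm (Fin 3)))
      (fun σ => inCyc (y (σ 0)) (y (σ 1) * y (σ 2)))
  ∪ bigOr (Finset.univ : Finset (Equiv.Perm (Fin 3)))
      (fun σ => inCyc (y (σ 0) * y (σ 1)) (y (σ 1) * y (σ 2)))

/-- `ω_n = ⋁_{0 ≤ i < j ≤ n} (x_i = x_j)`; it holds exactly in the groups of order at most `n`. -/
def omega (n : ℕ) : DFormula :=
  bigOr (ltPairs (Finset.Icc 0 n)) fun p => eqn (x p.1) (x p.2)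

/-- `(x³ = 1) ∨ (x⁴ = 1) ∨ (x⁵ = 1)`. -/
def delta2 : DFormula :=
  isOne (x 1 ^ 3) ∪ isOne (x 1 ^ 4) ∪ isOne (x 1 ^ 5)

/-- `[⋁ x_i²⁰ = 1] ∨ [⋁_{i<j} x_i = x_j] ∨ [⋁_{i<j} (x_i x_j)²⁰ = 1]
∨ [⋁_{i<j} (x_i x_j²)²⁰ = 1]`, with `i, j` in `{1, …, 9}`. -/
def delta3 : DFormula :=
  bigOr (Finset.Icc 1 9) (fun i => isOne (x i ^ 20))
  ∪ bigOr (ltPairs (Finset.Icc 1 9)) (fun p => eqn (x p.1) (x p.2))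
  ∪ bigOr (ltPairs (Finset.Icc 1 9)) (fun p => isOne ((x p.1 * x p.2) ^ 20))
  ∪ bigOr (ltPairs (Finset.Icc 1 9)) (fun p => isOne ((x p.1 * x p.2 ^ 2) ^ 20))

/-- `(x₁³⁰ = 1) ∨ (x₂³⁰ = 1) ∨ ((x₁x₂)¹⁵ = 1) ∨ ((x₁x₂²)¹⁵ = 1) ∨ ((x₁x₂³)¹⁵ = 1)`. -/
def delta4 : DFormula :=
  isOne (x 1 ^ 30) ∪ isOne (x 2 ^ 30) ∪ isOne ((x 1 * x 2) ^ 15)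
  ∪ isOne ((x 1 * x 2 ^ 2) ^ 15) ∪ isOne ((x 1 * x 2 ^ 3) ^ 15)

/-- `θ(x₁, x₂, x₃) ∨ [⋁_i x_i¹⁵ = 1] ∨ [⋁_{i≠j} (x_i x_j)¹⁵ = 1] ∨ [⋁_{i≠j} (x_i x_j²)¹⁵ = 1]
∨ [⋁_{i≠j} (x_i x_j³)¹⁵ = 1]`, with `i, j` in `{1, 2, 3}`. -/
def delta5 : DFormula :=
  theta ![x 1, x 2, x 3]
  ∪ bigOr (Finset.Icc 1 3) (fun i => isOne (x i ^ 15))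
  ∪ bigOr (Finset.Icc 1 3).offDiag (fun p => isOne ((x p.1 * x p.2) ^ 15))
  ∪ bigOr (Finset.Icc 1 3).offDiag (fun p => isOne ((x p.1 * x p.2 ^ 2) ^ 15))
  ∪ bigOr (Finset.Icc 1 3).offDiag (fun p => isOne ((x p.1 * x p.2 ^ 3) ^ 15))

/-- `(x₁¹² = 1) ∨ (x₂³⁰ = 1) ∨ ((x₁ x₁^{x₂})¹² = 1) ∨ ((x₁ (x₁³)^{x₂})¹² = 1)
∨ ((x₁² x₁^{x₂})¹² = 1)`. -/
def delta6 : DFormula :=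
  isOne (x 1 ^ 12) ∪ isOne (x 2 ^ 30) ∪ isOne ((x 1 * conj (x 1) (x 2)) ^ 12)
  ∪ isOne ((x 1 * conj (x 1 ^ 3) (x 2)) ^ 12) ∪ isOne ((x 1 ^ 2 * conj (x 1) (x 2)) ^ 12)

/-- `(x₁¹² = 1) ∨ (x₂¹² = 1) ∨ ((x₁x₂)¹² = 1) ∨ ((x₁x₂²)¹² = 1) ∨ ((x₁x₂³)¹² = 1)
∨ ((x₁x₂⁴)¹² = 1)`. -/
def delta7 : DFormula :=
  isOne (x 1 ^ 12) ∪ isOne (x 2 ^ 12) ∪ isOne ((x 1 * x 2) ^ 12)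
  ∪ isOne ((x 1 * x 2 ^ 2) ^ 12) ∪ isOne ((x 1 * x 2 ^ 3) ^ 12) ∪ isOne ((x 1 * x 2 ^ 4) ^ 12)

end DFormula

/-- `G` satisfies all formulas of `Γ`. -/
def Satisfies (G : Type v) [Group G] (Γ : Set DFormula) : Prop :=
  ∀ δ ∈ Γ, δ.HoldsIn G

/-- `G` belongs to the d-variety generated by `H`: every disjunctive identity of `H` is one
of `G`. -/
def InDVar (G : Type u) [Group G] (H : Type v) [Group H] : Prop :=
  ∀ δ : DFormula, δ.HoldsIn H → δ.HoldsIn G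

/-- `Γ` is a basis of disjunctive identities of `H`: its members are disjunctive identities of
`H`, and every group satisfying `Γ` belongs to the d-variety generated by `H`. -/
def IsDBasis (Γ : Set DFormula) (H : Type v) [Group H] : Prop :=
  Satisfies H Γ ∧ ∀ (G : Type u) [Group G], Satisfies G Γ → InDVar G H

/-- `G` is isomorphic to a section of `H`, that is, to a quotient of a subgroup of `H`. -/
def IsSection (G : Type u) [Group G] (H : Type v) [Group H] : Prop :=
  ∃ (K : Subgroup H) (N : Subgroup K) (_ : N.Normal), Nonempty (G ≃* K ⧸ N)

/-- The seven formulas. -/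
def sevenFormulas : Set DFormula :=
  {DFormula.omega 360, DFormula.delta2, DFormula.delta3, DFormula.delta4, DFormula.delta5,
    DFormula.delta6, DFormula.delta7}

/-
`ω₃₆₀` makes a group `G` satisfying the seven formulas finite. By `δ₂` its elements have order at
most `5`, `δ₇` leaves no `5`-subgroup of order greater than `5`, `δ₃` none of order greater than
`9` among the `3`-subgroups, and `δ₄`, `δ₅` none of order greater than `8` among the `2`-subgroups;
hence `|G|` divides `360`. Together with `δ₆`, which restricts the action of the normalizer of a
Sylow subgroup, Sylow counting leaves few orders. For those below `360` the group embeds in `A₆`,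
mostly through its action on a set of Sylow subgroups. For the order `360` the ten Sylow
`3`-subgroups are identified with the projective line over `𝔽₉`: a Sylow `3`-subgroup acts by the
translations, an element of order `4` of its normalizer by `z ↦ i z`, and an involution that swaps
`0` and `∞` by `z ↦ z⁻¹` up to powers of that rotation. So any two such groups are isomorphic, and
`A₆` is one of them.

Each formula holds in `A₆` by a search in which conjugation reduces one of the variables to a
representative of its cycle type. Finally, the class of groups satisfying a d-identity is closed
under sections, so being a section of `A₆` suffices.
-/

namespace DFormula

variable {G : Type v} [Group G] {H : Type u} [Group H] {δ ε : DFormula}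

/-- The disjunction `δ` is true when the variables take the values `g` in `G`. -/
def HoldsAt (δ : DFormula) (g : ℕ → G) : Prop :=
  ∃ f ∈ δ, FreeGroup.lift g f = 1

theorem HoldsAt.of_injective {φ : G →* H} (hφ : Function.Injective φ) {g : ℕ → G}
    (h : δ.HoldsAt (φ ∘ g)) : δ.HoldsAt g := by
  obtain ⟨f, hf, hf1⟩ := h
  have hlift : FreeGroup.lift (φ ∘ g) = φ.comp (FreeGroup.lift g) := by ext; simp
  exact ⟨f, hf, hφ (by rw [← MonoidHom.comp_apply, ← hlift, hf1, map_one])⟩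

theorem HoldsAt.map (φ : G →* H) {g : ℕ → G} (h : δ.HoldsAt g) : δ.HoldsAt (φ ∘ g) := by
  obtain ⟨f, hf, hf1⟩ := h
  have hlift : FreeGroup.lift (φ ∘ g) = φ.comp (FreeGroup.lift g) := by ext; simp
  exact ⟨f, hf, by rw [hlift, MonoidHom.comp_apply, hf1, map_one]⟩

theorem HoldsIn.of_injective {φ : G →* H} (hφ : Function.Injective φ) (h : δ.HoldsIn H) :
    δ.HoldsIn G :=
  fun _ => HoldsAt.of_injective hφ (h _)

theorem HoldsIn.of_surjective {φ : G →* H} (hφ : Function.Surjective φ) (h : δ.HoldsIn G) :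
    δ.HoldsIn H := by
  intro g
  obtain ⟨k, rfl⟩ := hφ.comp_left g
  exact HoldsAt.map φ (h k)

theorem holdsAt_isOne {f : FreeGroup ℕ} {g : ℕ → G} :
    (isOne f).HoldsAt g ↔ FreeGroup.lift g f = 1 := by
  simp [HoldsAt, isOne]

theorem holdsAt_eqn {f h : FreeGroup ℕ} {g : ℕ → G} :
    (eqn f h).HoldsAt g ↔ FreeGroup.lift g f = FreeGroup.lift g h := by
  simp [HoldsAt, eqn, mul_inv_eq_one]

theorem holdsAt_union {g : ℕ → G} : HoldsAt (δ ∪ ε) g ↔ δ.HoldsAt g ∨ ε.HoldsAt g := by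
  simp [HoldsAt, or_and_right, exists_or]

theorem holdsAt_bigOr {ι : Type} {s : Finset ι} {δ : ι → DFormula} {g : ℕ → G} :
    (bigOr s δ).HoldsAt g ↔ ∃ i ∈ s, (δ i).HoldsAt g := by
  simp only [HoldsAt, bigOr, Finset.mem_biUnion]
  tauto

/-- The meaning in a group `G` of the formula `a ∈ ⟨b⟩`. -/
def InCyc (a b : G) : Prop := a = 1 ∨ a = b ∨ a = b ^ 2 ∨ a = b ^ 3

theorem holdsAt_inCyc {a b : FreeGroup ℕ} {g : ℕ → G} :
    (inCyc a b).HoldsAt g ↔ InCyc (FreeGroup.lift g a) (FreeGroup.lift g b) := by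
  simp only [inCyc, holdsAt_union, holdsAt_isOne, holdsAt_eqn, InCyc, map_pow, or_assoc]

/-- The meaning in a group `G` of the formula `θ(y 0, y 1, y 2)`. -/
def Theta (y : Fin 3 → G) : Prop :=
  (∃ i j, i ≠ j ∧ InCyc (y i) (y j)) ∨
  (∃ σ : Equiv.Perm (Fin 3), InCyc (y (σ 0)) (y (σ 1) * y (σ 2))) ∨
  ∃ σ : Equiv.Perm (Fin 3), InCyc (y (σ 0) * y (σ 1)) (y (σ 1) * y (σ 2))

theorem holdsAt_theta {y : Fin 3 → FreeGroup ℕ} {g : ℕ → G} :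
    (theta y).HoldsAt g ↔ Theta fun i => FreeGroup.lift g (y i) := by
  simp only [theta, holdsAt_union, holdsAt_bigOr, holdsAt_inCyc, Theta, map_mul,
    Finset.mem_offDiag, Finset.mem_univ, true_and, Prod.exists, or_assoc]

theorem exists_mem_Icc_one_iff {n : ℕ} {p : ℕ → Prop} :
    (∃ i ∈ Finset.Icc 1 n, p i) ↔ ∃ i : Fin n, p (i + 1) := by
  simp only [Finset.mem_Icc]
  constructor
  · rintro ⟨i, ⟨h1, hn⟩, hi⟩
    exact ⟨⟨i - 1, by omega⟩, by simpa [Nat.sub_add_cancel h1] using hi⟩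
  · rintro ⟨i, hi⟩
    exact ⟨i + 1, ⟨by omega, by omega⟩, hi⟩

theorem exists_mem_ltPairs_Icc_one_iff {n : ℕ} {p : ℕ × ℕ → Prop} :
    (∃ a ∈ ltPairs (Finset.Icc 1 n), p a) ↔ ∃ i j : Fin n, i < j ∧ p (i + 1, j + 1) := by
  simp only [ltPairs, Finset.mem_filter, Finset.mem_product, Prod.exists, and_assoc,
    exists_and_left, exists_mem_Icc_one_iff, add_lt_add_iff_right, Fin.val_fin_lt]

theorem exists_mem_offDiag_Icc_one_iff {n : ℕ} {p : ℕ × ℕ → Prop} :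
    (∃ a ∈ (Finset.Icc 1 n).offDiag, p a) ↔ ∃ i j : Fin n, i ≠ j ∧ p (i + 1, j + 1) := by
  simp only [Finset.mem_offDiag, Prod.exists, and_assoc, exists_and_left,
    exists_mem_Icc_one_iff, ne_eq, add_left_inj, Fin.val_inj]

theorem forall_values_iff {n : ℕ} {p : (Fin n → G) → Prop} :
    (∀ g : ℕ → G, p fun i => g (i + 1)) ↔ ∀ y, p y := by
  have hinj : Function.Injective fun i : Fin n => (i : ℕ) + 1 := fun i j h => by
    simpa [Fin.val_inj] using h
  refine ⟨fun h y => ?_, fun h g => h _⟩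
  have hext : (fun i : Fin n => Function.extend (fun i : Fin n => (i : ℕ) + 1) y 1 (i + 1)) = y :=
    funext fun i => hinj.extend_apply y 1 i
  exact hext ▸ h _

theorem omega_holdsIn_iff {n : ℕ} :
    (omega n).HoldsIn G ↔ ∀ g : ℕ → G, ∃ i j, i < j ∧ j ≤ n ∧ g i = g j := by
  refine forall_congr' fun g => holdsAt_bigOr.trans ?_
  simp only [holdsAt_eqn, x, FreeGroup.lift_apply_of, ltPairs, Finset.mem_filter,
    Finset.mem_product, Finset.mem_Icc, Prod.exists]
  constructor
  · rintro ⟨i, j, ⟨⟨-, -, hj⟩, hij⟩, h⟩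
    exact ⟨i, j, hij, hj, h⟩
  · rintro ⟨i, j, hij, hj, h⟩
    exact ⟨i, j, ⟨⟨⟨by omega, by omega⟩, by omega, hj⟩, hij⟩, h⟩

theorem finite_of_omega {n : ℕ} (h : (omega n).HoldsIn G) : Finite G := by
  by_contra hG
  rw [not_finite_iff_infinite] at hG
  obtain ⟨i, j, hij, -, heq⟩ := omega_holdsIn_iff.1 h (Infinite.natEmbedding G)
  exact hij.ne ((Infinite.natEmbedding G).injective heq)

theorem omega_holdsIn_of_card_le [Finite G] {n : ℕ} (h : Nat.card G ≤ n) :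
    (omega n).HoldsIn G := by
  refine omega_holdsIn_iff.2 fun g => ?_
  have : Fintype G := Fintype.ofFinite G
  obtain ⟨i, j, hij, heq⟩ := Fintype.exists_ne_map_eq_of_card_lt (fun i : Fin (n + 1) => g i)
    (by rw [Fintype.card_fin, ← Nat.card_eq_fintype_card]; omega)
  rcases lt_or_gt_of_ne hij with hlt | hlt
  · exact ⟨i, j, hlt, by omega, heq⟩
  · exact ⟨j, i, hlt, by omega, heq.symm⟩

theorem delta2_holdsIn_iff :
    delta2.HoldsIn G ↔ ∀ a : G, a ^ 3 = 1 ∨ a ^ 4 = 1 ∨ a ^ 5 = 1 := by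
  have : delta2.HoldsIn G ↔ ∀ g : ℕ → G, g 1 ^ 3 = 1 ∨ g 1 ^ 4 = 1 ∨ g 1 ^ 5 = 1 := by
    simp [HoldsIn, delta2, isOne, x]
  rw [this]
  exact ⟨fun h a => h fun _ => a, fun h g => h _⟩

theorem delta3_holdsIn_iff :
    delta3.HoldsIn G ↔ ∀ y : Fin 9 → G, (∃ i, y i ^ 20 = 1) ∨
      ∃ i j, i < j ∧ (y i = y j ∨ (y i * y j) ^ 20 = 1 ∨ (y i * y j ^ 2) ^ 20 = 1) := by
  rw [← forall_values_iff]
  refine forall_congr' fun g => (holdsAt_union (g := g)).trans ?_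
  simp only [holdsAt_union, holdsAt_bigOr, holdsAt_isOne, holdsAt_eqn, exists_mem_Icc_one_iff,
    exists_mem_ltPairs_Icc_one_iff, x, map_mul, map_pow, FreeGroup.lift_apply_of, or_assoc,
    and_or_left, exists_or]

theorem delta4_holdsIn_iff :
    delta4.HoldsIn G ↔ ∀ a b : G, a ^ 30 = 1 ∨ b ^ 30 = 1 ∨ (a * b) ^ 15 = 1 ∨
      (a * b ^ 2) ^ 15 = 1 ∨ (a * b ^ 3) ^ 15 = 1 := by
  have : delta4.HoldsIn G ↔ ∀ g : ℕ → G, g 1 ^ 30 = 1 ∨ g 2 ^ 30 = 1 ∨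
      (g 1 * g 2) ^ 15 = 1 ∨ (g 1 * g 2 ^ 2) ^ 15 = 1 ∨ (g 1 * g 2 ^ 3) ^ 15 = 1 := by
    simp [HoldsIn, delta4, isOne, x]
  rw [this]
  exact ⟨fun h a b => h fun i => if i = 1 then a else b, fun h g => h _ _⟩

theorem delta5_holdsIn_iff :
    delta5.HoldsIn G ↔ ∀ y : Fin 3 → G, Theta y ∨ (∃ i, y i ^ 15 = 1) ∨
      ∃ i j, i ≠ j ∧ ((y i * y j) ^ 15 = 1 ∨ (y i * y j ^ 2) ^ 15 = 1 ∨
        (y i * y j ^ 3) ^ 15 = 1) := by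
  rw [← forall_values_iff]
  refine forall_congr' fun g => (holdsAt_union (g := g)).trans ?_
  have hvar : (fun i : Fin 3 => FreeGroup.lift g (![x 1, x 2, x 3] i)) =
      fun i : Fin 3 => g (i + 1) := by
    funext i; fin_cases i <;> simp [x]
  simp only [holdsAt_union, holdsAt_theta, hvar]
  simp only [holdsAt_bigOr, holdsAt_isOne, exists_mem_Icc_one_iff, exists_mem_offDiag_Icc_one_iff,
    x, map_mul, map_pow, FreeGroup.lift_apply_of, or_assoc, and_or_left, exists_or]

theorem delta6_holdsIn_iff :
    delta6.HoldsIn G ↔ ∀ a b : G, a ^ 12 = 1 ∨ b ^ 30 = 1 ∨ (a * (b⁻¹ * a * b)) ^ 12 = 1 ∨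
      (a * (b⁻¹ * a ^ 3 * b)) ^ 12 = 1 ∨ (a ^ 2 * (b⁻¹ * a * b)) ^ 12 = 1 := by
  have : delta6.HoldsIn G ↔ ∀ g : ℕ → G, g 1 ^ 12 = 1 ∨ g 2 ^ 30 = 1 ∨
      (g 1 * ((g 2)⁻¹ * g 1 * g 2)) ^ 12 = 1 ∨ (g 1 * ((g 2)⁻¹ * g 1 ^ 3 * g 2)) ^ 12 = 1 ∨
      (g 1 ^ 2 * ((g 2)⁻¹ * g 1 * g 2)) ^ 12 = 1 := by
    simp [HoldsIn, delta6, isOne, x, conj]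
  rw [this]
  exact ⟨fun h a b => h fun i => if i = 1 then a else b, fun h g => h _ _⟩

theorem delta7_holdsIn_iff :
    delta7.HoldsIn G ↔ ∀ a b : G, a ^ 12 = 1 ∨ b ^ 12 = 1 ∨ (a * b) ^ 12 = 1 ∨
      (a * b ^ 2) ^ 12 = 1 ∨ (a * b ^ 3) ^ 12 = 1 ∨ (a * b ^ 4) ^ 12 = 1 := by
  have : delta7.HoldsIn G ↔ ∀ g : ℕ → G, g 1 ^ 12 = 1 ∨ g 2 ^ 12 = 1 ∨
      (g 1 * g 2) ^ 12 = 1 ∨ (g 1 * g 2 ^ 2) ^ 12 = 1 ∨ (g 1 * g 2 ^ 3) ^ 12 = 1 ∨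
      (g 1 * g 2 ^ 4) ^ 12 = 1 := by
    simp [HoldsIn, delta7, isOne, x]
  rw [this]
  exact ⟨fun h a b => h fun i => if i = 1 then a else b, fun h g => h _ _⟩

end DFormula

open DFormula

section Satisfies

variable {G : Type v} [Group G] {H : Type u} [Group H]

theorem Satisfies.of_injective {Γ : Set DFormula} {φ : G →* H} (hφ : Function.Injective φ)
    (h : Satisfies H Γ) : Satisfies G Γ :=
  fun δ hδ => (h δ hδ).of_injective hφ

theorem Satisfies.subgroup {Γ : Set DFormula} (h : Satisfies G Γ) (K : Subgroup G) :
    Satisfies K Γ :=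
  h.of_injective K.subtype_injective

theorem IsSection.inDVar (h : IsSection G H) : InDVar G H := by
  obtain ⟨K, N, _, ⟨e⟩⟩ := h
  intro δ hδ
  have hK : δ.HoldsIn K := hδ.of_injective K.subtype_injective
  have hKN : δ.HoldsIn (K ⧸ N) := hK.of_surjective (QuotientGroup.mk'_surjective N)
  exact hKN.of_injective (φ := e.toMonoidHom) e.injective

theorem isSection_of_injective {φ : G →* H} (hφ : Function.Injective φ) : IsSection G H :=
  ⟨φ.range, ⊥, inferInstance,
    ⟨(MonoidHom.ofInjective hφ).trans QuotientGroup.quotientBot.symm⟩⟩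

theorem satisfies_sevenFormulas_iff :
    Satisfies G sevenFormulas ↔ (omega 360).HoldsIn G ∧ delta2.HoldsIn G ∧ delta3.HoldsIn G ∧
      delta4.HoldsIn G ∧ delta5.HoldsIn G ∧ delta6.HoldsIn G ∧ delta7.HoldsIn G := by
  simp [Satisfies, sevenFormulas]

end Satisfies

section PGroups

variable {G : Type v} [Group G] {p : ℕ}

theorem eq_one_of_pow_eq_one_of_coprime {a : G} {m n : ℕ} (hm : a ^ m = 1) (hn : a ^ n = 1)
    (h : Nat.Coprime m n) : a = 1 := by
  rw [← orderOf_dvd_iff_pow_eq_one] at hm hn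
  exact orderOf_eq_one_iff.1 (Nat.eq_one_of_dvd_coprimes h hm hn)

theorem eq_one_of_pow_eq_one_of_isPGroup (hP : IsPGroup p G) {n : ℕ} (hn : p.Coprime n) {a : G}
    (ha : a ^ n = 1) : a = 1 :=
  (hP.powEquiv hn).injective (by simpa using ha)

theorem index_eq_one_or_two_of_mul_mem {H : Subgroup G} (h : ∀ a ∉ H, ∀ b ∉ H, a * b ∈ H) :
    H.index = 1 ∨ H.index = 2 := by
  by_cases htop : H = ⊤
  · exact Or.inl (Subgroup.index_eq_one.2 htop)
  · obtain ⟨b, hb⟩ : ∃ b, b ∉ H := by simpa [Subgroup.eq_top_iff'] using htop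
    exact Or.inr (Subgroup.index_eq_two_iff_exists_notMem_and.2
      ⟨b, hb, fun a => or_iff_not_imp_right.2 fun ha => h a ha b hb⟩)

theorem orderOf_mem_Icc_of_delta2 (h2 : delta2.HoldsIn G) (a : G) :
    1 ≤ orderOf a ∧ orderOf a ≤ 5 := by
  have h := delta2_holdsIn_iff.1 h2 a
  simp only [← orderOf_dvd_iff_pow_eq_one] at h
  rcases h with h | h | h <;>
    exact ⟨Nat.pos_of_dvd_of_pos h (by norm_num),
      (Nat.le_of_dvd (by norm_num) h).trans (by norm_num)⟩

theorem orderOf_eq_of_delta2 (h2 : delta2.HoldsIn G) [Fact p.Prime] (hp : p ≠ 2) {x : G} {k : ℕ}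
    (hx : orderOf x = p ^ k) (hx1 : x ≠ 1) : orderOf x = p := by
  have hp3 : 3 ≤ p := (Fact.out : p.Prime).two_le.lt_of_ne' hp
  have hle := (orderOf_mem_Icc_of_delta2 h2 x).2
  have hk0 : k ≠ 0 := fun hk => hx1 (orderOf_eq_one_iff.1 (by simp [hx, hk]))
  have hk2 : k < 2 := by
    by_contra! hk
    have := (Nat.pow_le_pow_left hp3 2).trans (Nat.pow_le_pow_right (by omega) hk)
    omega
  rw [hx, show k = 1 by omega, pow_one]

theorem isCyclic_of_delta7 (h7 : delta7.HoldsIn G) (hP : IsPGroup p G) (hp : p.Coprime 12) :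
    IsCyclic G := by
  have h12 : ∀ {a : G}, a ^ 12 = 1 → a = 1 := eq_one_of_pow_eq_one_of_isPGroup hP hp
  rcases subsingleton_or_nontrivial G with _ | _
  · infer_instance
  obtain ⟨b, hb⟩ := exists_ne (1 : G)
  have hmem : ∀ (a : G) (k : ℕ), (a * b ^ k) ^ 12 = 1 → a ∈ Subgroup.zpowers b := fun a k h => by
    rw [mul_eq_one_iff_eq_inv.1 (h12 h)]
    exact inv_mem (Subgroup.npow_mem_zpowers b k)
  refine ⟨b, fun a => ?_⟩
  rcases delta7_holdsIn_iff.1 h7 a b with h | h | h | h | h | h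
  · exact hmem a 0 (by simpa using h)
  · exact absurd (h12 h) hb
  · exact hmem a 1 (by simpa using h)
  · exact hmem a 2 h
  · exact hmem a 3 h
  · exact hmem a 4 h

/-- Apply the formula to nine elements of one coset `a M ≠ M`: the products lie outside `M`, since
`G ⧸ M` has no elements of order two, and `u v² = 1` means `u = v`. -/
theorem eq_top_of_delta3 (h3 : delta3.HoldsIn G) (hexp : ∀ a : G, a ^ 3 = 1) (M : Subgroup G)
    [M.Normal] (hM : 9 ≤ Nat.card M) : M = ⊤ := by
  have h20 : ∀ {a : G}, a ^ 20 = 1 → a = 1 := fun h =>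
    eq_one_of_pow_eq_one_of_coprime (hexp _) h (by norm_num)
  by_contra hne
  obtain ⟨a, ha⟩ : ∃ a, a ∉ M := by simpa [Subgroup.eq_top_iff'] using hne
  have : Finite M := Nat.finite_of_card_ne_zero (by omega)
  obtain ⟨ε⟩ : Nonempty (Fin 9 ↪ M) := by
    have := Fintype.ofFinite M
    exact Function.Embedding.nonempty_of_card_le
      (by rwa [Fintype.card_fin, ← Nat.card_eq_fintype_card])
  have hinj : ∀ {i j}, i < j → a * ε i ≠ a * ε j := fun hij h =>
    hij.ne (ε.injective (Subtype.ext (mul_left_cancel h)))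
  rcases delta3_holdsIn_iff.1 h3 fun i => a * ε i with ⟨i, h⟩ | ⟨i, j, hij, h | h | h⟩
  · exact ha ((mul_mem_cancel_right (ε i).2).1 (h20 h ▸ one_mem M))
  · exact hinj hij h
  · have hsq : (a : G ⧸ M) ^ 2 = 1 := by
      simpa [(QuotientGroup.eq_one_iff (_ : G)).2 (ε _).2, pow_two] using
        congrArg (QuotientGroup.mk' M) (h20 h)
    have hcube : (a : G ⧸ M) ^ 3 = 1 := by rw [← QuotientGroup.mk_pow, hexp, QuotientGroup.mk_one]
    exact ha ((QuotientGroup.eq_one_iff a).1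
      (eq_one_of_pow_eq_one_of_coprime hsq hcube (by norm_num)))
  · refine hinj hij ((mul_eq_one_iff_eq_inv.1 (h20 h)).trans ?_)
    rw [inv_eq_iff_mul_eq_one, ← pow_succ, hexp]

theorem log_card_le_two_of_delta3 (h3 : delta3.HoldsIn G) (hexp : ∀ a : G, a ^ 3 = 1) {k : ℕ}
    (hk : Nat.card G = 3 ^ k) : k ≤ 2 := by
  by_contra! hk3
  obtain ⟨k, rfl⟩ : ∃ j, k = j + 1 := ⟨k - 1, by omega⟩
  have : Finite G := Nat.finite_of_card_ne_zero (by simp [hk])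
  obtain ⟨M, hM⟩ := Sylow.exists_subgroup_card_pow_prime (G := G) 3 (hk ▸ pow_dvd_pow 3 k.le_succ)
  have hindex : M.index = 3 := by
    have := M.card_mul_index
    rw [hM, hk, pow_succ] at this
    exact Nat.eq_of_mul_eq_mul_left (by positivity) this
  have hnormal : M.Normal := Subgroup.normal_of_index_eq_minFac_card (by
    rw [hindex, hk, Nat.Prime.pow_minFac Nat.prime_three k.succ_ne_zero])
  have htop := eq_top_of_delta3 h3 hexp M
    (hM ▸ (Nat.pow_le_pow_right (by norm_num) (by omega) : 3 ^ 2 ≤ 3 ^ k))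
  rw [htop, Subgroup.index_top] at hindex
  omega

theorem exists_of_theta_of_sq_eq_one {G : Type*} [CommGroup G] (hexp : ∀ a : G, a ^ 2 = 1)
    {y : Fin 3 → G} (hy : Theta y) :
    (∃ i, y i = 1) ∨ (∃ i j, i ≠ j ∧ y i = y j) ∨ y 0 * y 1 * y 2 = 1 := by
  have hcyc : ∀ {a b : G}, InCyc a b → a = 1 ∨ a = b := by
    rintro a b (h | h | h | h) <;> simp [h, hexp, pow_succ _ 2]
  have heq : ∀ {a b : G}, a * b = 1 → a = b := fun h => by
    rw [mul_eq_one_iff_eq_inv.1 h, inv_eq_iff_mul_eq_one, ← pow_two, hexp]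
  have hprod (σ : Equiv.Perm (Fin 3)) : y (σ 0) * y (σ 1) * y (σ 2) = y 0 * y 1 * y 2 := by
    rw [← Fin.prod_univ_three, ← Fin.prod_univ_three (fun i => y (σ i)), Equiv.prod_comp σ y]
  rcases hy with ⟨i, j, hij, h⟩ | ⟨σ, h⟩ | ⟨σ, h⟩ <;> rcases hcyc h with h | h
  · exact Or.inl ⟨i, h⟩
  · exact Or.inr (Or.inl ⟨i, j, hij, h⟩)
  · exact Or.inl ⟨σ 0, h⟩
  · refine Or.inr (Or.inr ?_)
    rw [← hprod σ, mul_assoc, ← h, ← pow_two, hexp]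
  · exact Or.inr (Or.inl ⟨σ 0, σ 1, by simp, heq h⟩)
  · rw [mul_comm, mul_right_inj] at h
    exact Or.inr (Or.inl ⟨σ 0, σ 2, by simp, h⟩)

theorem card_le_four_of_delta5 (h5 : delta5.HoldsIn G) [Finite G] (hexp : ∀ a : G, a ^ 2 = 1) :
    Nat.card G ≤ 4 := by
  have hsq : ∀ a : G, a * a = 1 := fun a => by rw [← pow_two, hexp]
  have hinv : ∀ a : G, a⁻¹ = a := fun a => inv_eq_of_mul_eq_one_right (hsq a)
  let _ : CommGroup G := CommGroup.mk fun a b => by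
    have := hinv (a * b)
    rw [mul_inv_rev, hinv, hinv] at this
    exact this.symm
  have h15 : ∀ {a : G}, a ^ 15 = 1 → a = 1 := fun h =>
    eq_one_of_pow_eq_one_of_coprime (hexp _) h (by norm_num)
  have hcases : ∀ y : Fin 3 → G,
      (∃ i, y i = 1) ∨ (∃ i j, i ≠ j ∧ y i = y j) ∨ y 0 * y 1 * y 2 = 1 := fun y => by
    have hmul : ∀ i j, y i * y j = 1 → y i = y j := fun i j h => by
      rw [mul_eq_one_iff_eq_inv.1 h, hinv]
    rcases delta5_holdsIn_iff.1 h5 y with h | ⟨i, h⟩ | ⟨i, j, hij, h | h | h⟩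
    · exact exists_of_theta_of_sq_eq_one hexp h
    · exact Or.inl ⟨i, h15 h⟩
    · exact Or.inr (Or.inl ⟨i, j, hij, hmul i j (h15 h)⟩)
    · exact Or.inl ⟨i, by simpa [hexp] using h15 h⟩
    · exact Or.inr (Or.inl ⟨i, j, hij, hmul i j (by simpa [pow_succ _ 2, hexp] using h15 h)⟩)
  by_contra! hcard
  classical
  have hout : ∀ s : Finset G, s.card ≤ 4 → ∃ a, a ∉ s := fun s hs => by
    have := Fintype.ofFinite G
    rw [Nat.card_eq_fintype_card] at hcard
    simpa using Finset.exists_mem_notMem_of_card_lt_card (hs.trans_lt hcard)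
  obtain ⟨a, ha⟩ := hout {1} (by simp)
  obtain ⟨b, hb⟩ := hout {1, a} (Finset.card_le_two.trans (by norm_num))
  obtain ⟨c, hc⟩ := hout {1, a, b, a * b} Finset.card_le_four
  simp only [Finset.mem_singleton, Finset.mem_insert, not_or] at ha hb hc
  have habc : a * b * c ≠ 1 := fun h => hc.2.2.2 (by
    rw [eq_inv_of_mul_eq_one_right h, hinv])
  have heq : a = b ∨ a = c ∨ b = c := by
    simpa [Fin.exists_fin_succ, ha, hb, hc, habc, eq_comm] using hcases ![a, b, c]
  rcases heq with h | h | h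
  exacts [hb.2 h.symm, hc.2.1 h.symm, hc.2.2.1 h.symm]

theorem orderOf_cases_of_isPGroup_two (h2 : delta2.HoldsIn G) (hP : IsPGroup 2 G) (a : G) :
    orderOf a = 1 ∨ orderOf a = 2 ∨ orderOf a = 4 := by
  obtain ⟨k, hk⟩ := IsPGroup.iff_orderOf.1 hP a
  have hle := (orderOf_mem_Icc_of_delta2 h2 a).2
  rw [hk] at hle ⊢
  have hk3 : k < 3 := (Nat.pow_lt_pow_iff_right (a := 2) (by norm_num)).1 (by omega)
  interval_cases k <;> simp

theorem exists_orderOf_eq_four_of_four_lt_card (h2 : delta2.HoldsIn G) (h5 : delta5.HoldsIn G)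
    (hP : IsPGroup 2 G) (hcard : 4 < Nat.card G) : ∃ x : G, orderOf x = 4 := by
  have : Finite G := Nat.finite_of_card_ne_zero (by omega)
  by_contra! hne
  refine (card_le_four_of_delta5 h5 fun a => ?_).not_gt hcard
  rw [← orderOf_dvd_iff_pow_eq_one]
  rcases orderOf_cases_of_isPGroup_two h2 hP a with h | h | h
  · exact h ▸ one_dvd 2
  · exact h.dvd
  · exact absurd h (hne a)

theorem mul_pow_fifteen_of_delta4 (h4 : delta4.HoldsIn G) {x y : G} (hx : orderOf x = 4)
    (hy : orderOf y = 4) :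
    (x * y) ^ 15 = 1 ∨ (x * y ^ 2) ^ 15 = 1 ∨ (x * y ^ 3) ^ 15 = 1 := by
  have h30 : ∀ {z : G}, orderOf z = 4 → z ^ 30 ≠ 1 := fun hz h => by
    rw [← orderOf_dvd_iff_pow_eq_one, hz] at h
    omega
  simpa [h30 hx, h30 hy] using delta4_holdsIn_iff.1 h4 x y

theorem mem_zpowers_of_orderOf_eq_four (h4 : delta4.HoldsIn G) (hP : IsPGroup 2 G) {x y : G}
    (hx : orderOf x = 4) (hy : orderOf y = 4) : y ∈ Subgroup.zpowers x := by
  have h15 : ∀ {a : G}, a ^ 15 = 1 → a = 1 := eq_one_of_pow_eq_one_of_isPGroup hP (by norm_num)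
  have hy4 : y ^ 4 = 1 := hy ▸ pow_orderOf_eq_one y
  rcases mul_pow_fifteen_of_delta4 h4 hx hy with h | h | h
  · rw [eq_inv_of_mul_eq_one_right (h15 h)]
    exact inv_mem (Subgroup.mem_zpowers x)
  · have hx2 : x ^ 2 = 1 := by
      rw [mul_eq_one_iff_eq_inv.1 (h15 h), inv_pow, ← pow_mul, hy4, inv_one]
    have := orderOf_le_of_pow_eq_one (by norm_num) hx2
    omega
  · have hxy : x = y := by
      rw [mul_eq_one_iff_eq_inv.1 (h15 h), inv_eq_iff_mul_eq_one, ← pow_succ, hy4]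
    exact hxy ▸ Subgroup.mem_zpowers x

theorem inverts_of_notMem_zpowers (h2 : delta2.HoldsIn G) (h4 : delta4.HoldsIn G)
    (hP : IsPGroup 2 G) {x y : G} (hx : orderOf x = 4) (hy : y ∉ Subgroup.zpowers x) :
    orderOf y = 2 ∧ y * x = x⁻¹ * y := by
  have hinvol : ∀ {z}, z ∉ Subgroup.zpowers x → orderOf z = 2 := fun {z} hz => by
    rcases orderOf_cases_of_isPGroup_two h2 hP z with h | h | h
    · exact absurd (orderOf_eq_one_iff.1 h ▸ one_mem _) hz
    · exact h
    · exact absurd (mem_zpowers_of_orderOf_eq_four h4 hP hx h) hz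
  have hself : ∀ {z : G}, orderOf z = 2 → z⁻¹ = z := fun {z} hz =>
    inv_eq_of_mul_eq_one_right (by rw [← pow_two, ← hz, pow_orderOf_eq_one])
  have hyx : orderOf (y * x) = 2 :=
    hinvol (mt (mul_mem_cancel_right (Subgroup.mem_zpowers x)).1 hy)
  exact ⟨hinvol hy, by rw [← hself hyx, mul_inv_rev, hself (hinvol hy)]⟩

/-- Of two elements outside `⟨x⟩` each inverts `x`, so their product centralizes `x`. -/
theorem card_le_eight (h2 : delta2.HoldsIn G) (h4 : delta4.HoldsIn G) (h5 : delta5.HoldsIn G)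
    (hP : IsPGroup 2 G) : Nat.card G ≤ 8 := by
  rcases le_or_gt (Nat.card G) 4 with hle | hlt
  · omega
  obtain ⟨x, hx⟩ := exists_orderOf_eq_four_of_four_lt_card h2 h5 hP hlt
  have hinv := fun y (hy : y ∉ Subgroup.zpowers x) =>
    (inverts_of_notMem_zpowers h2 h4 hP hx hy).2
  have hmul : ∀ {y z}, y ∉ Subgroup.zpowers x → z ∉ Subgroup.zpowers x →
      y * z ∈ Subgroup.zpowers x := fun {y z} hy hz => by
    by_contra hyz
    have hcomm : y * z * x = x * (y * z) := by
      have hyx' : y * x⁻¹ = x * y := by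
        rw [mul_inv_eq_iff_eq_mul, mul_assoc, hinv y hy, mul_inv_cancel_left]
      rw [mul_assoc, hinv z hz, ← mul_assoc, hyx', mul_assoc]
    have hx2 : x ^ 2 = 1 := by
      rw [hinv _ hyz, mul_left_inj] at hcomm
      rw [pow_two, mul_eq_one_iff_eq_inv, hcomm]
    have := orderOf_le_of_pow_eq_one (by norm_num) hx2
    omega
  have hindex := index_eq_one_or_two_of_mul_mem fun y hy z hz => hmul hy hz
  rw [← (Subgroup.zpowers x).card_mul_index, Nat.card_zpowers, hx]
  omega

theorem Satisfies.card_dvd_of_isPGroup (hG : Satisfies G sevenFormulas) [Fact p.Prime]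
    (hP : IsPGroup p G) : Nat.card G ∣ 360 := by
  obtain ⟨homega, h2, h3, h4, h5, -, h7⟩ := satisfies_sevenFormulas_iff.1 hG
  have := finite_of_omega homega
  obtain ⟨k, hk⟩ := IsPGroup.iff_card.1 hP
  have hp : p.Prime := Fact.out
  obtain rfl | rfl | hp5 : p = 2 ∨ p = 3 ∨ p.Coprime 12 := by
    by_cases h : p ∣ 2 ^ 2 * 3
    · rcases (Nat.Prime.dvd_mul hp).1 h with h | h
      · exact Or.inl ((Nat.prime_dvd_prime_iff_eq hp Nat.prime_two).1 (hp.dvd_of_dvd_pow h))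
      · exact Or.inr (Or.inl ((Nat.prime_dvd_prime_iff_eq hp Nat.prime_three).1 h))
    · exact Or.inr (Or.inr ((Nat.Prime.coprime_iff_not_dvd hp).2 h))
  · have hle := card_le_eight h2 h4 h5 hP
    rw [hk] at hle ⊢
    have hk3 : k ≤ 3 := (Nat.pow_le_pow_iff_right (by norm_num)).1 hle
    exact (pow_dvd_pow 2 hk3).trans (by norm_num)
  · have hexp : ∀ a : G, a ^ 3 = 1 := fun a => by
      by_cases ha : a = 1
      · simp [ha]
      · obtain ⟨j, hj⟩ := IsPGroup.iff_orderOf.1 hP a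
        exact orderOf_dvd_iff_pow_eq_one.1 (orderOf_eq_of_delta2 h2 (by norm_num) hj ha).dvd
    rw [hk]
    exact (pow_dvd_pow 3 (log_card_le_two_of_delta3 h3 hexp hk)).trans (by norm_num)
  · have := isCyclic_of_delta7 h7 hP hp5
    obtain ⟨x, hx⟩ := IsCyclic.exists_ofOrder_eq_natCard (α := G)
    have hle := orderOf_mem_Icc_of_delta2 h2 x
    rw [← hx]
    generalize orderOf x = n at hle
    obtain ⟨h1, h5⟩ := hle
    interval_cases n <;> norm_num

theorem Satisfies.card_dvd (hG : Satisfies G sevenFormulas) : Nat.card G ∣ 360 := by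
  rw [Nat.dvd_iff_prime_pow_dvd_dvd]
  intro p k hp hk
  have := Fact.mk hp
  have : Finite G := finite_of_omega (satisfies_sevenFormulas_iff.1 hG).1
  obtain ⟨K, hK⟩ := Sylow.exists_subgroup_card_pow_prime p hk
  exact hK ▸ (hG.subgroup K).card_dvd_of_isPGroup (IsPGroup.of_card hK)

end PGroups

section SylowSubgroups

variable {G : Type v} [Group G] {p : ℕ}

instance fact_prime_five : Fact (Nat.Prime 5) := ⟨Nat.prime_five⟩

theorem mem_sylow_of_mem_normalizer [Fact p.Prime] (P : Sylow p G) {x : G} {k : ℕ}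
    (hx : x ^ p ^ k = 1) (h : x ∈ Subgroup.normalizer (P : Set G)) : x ∈ P := by
  obtain ⟨j, -, hj⟩ := (Nat.dvd_prime_pow Fact.out).1 (orderOf_dvd_of_pow_eq_one hx)
  have hz : IsPGroup p (Subgroup.zpowers x) := IsPGroup.of_card (by rw [Nat.card_zpowers, hj])
  have hmem : x ∈ Subgroup.zpowers x ⊓ Subgroup.normalizer (P : Set G) :=
    ⟨Subgroup.mem_zpowers x, h⟩
  rw [hz.inf_normalizer_sylow P] at hmem
  exact hmem.2

theorem card_sylow_eq_of_card_eq_mul [Finite G] [Fact p.Prime] {k m : ℕ} (P : Sylow p G)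
    (h : Nat.card G = p ^ k * m) (hm : p.Coprime m) : Nat.card P = p ^ k := by
  obtain ⟨j, hj⟩ := IsPGroup.iff_card.1 P.2
  refine Nat.dvd_antisymm ?_ (P.pow_dvd_card_of_pow_dvd_card (h ▸ dvd_mul_right _ m))
  have hdvd : Nat.card P ∣ p ^ k * m := h ▸ Subgroup.card_subgroup_dvd_card (P : Subgroup G)
  exact (hj ▸ hm.pow_left j).dvd_of_dvd_mul_right hdvd

theorem exists_notMem_zpowers {x : G} (h : orderOf x < Nat.card G) :
    ∃ y : G, y ∉ Subgroup.zpowers x := by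
  by_contra! hall
  rw [← Nat.card_zpowers, (Subgroup.eq_top_iff' _).2 hall, Subgroup.card_top] at h
  exact h.false

theorem disjoint_zpowers_of_notMem [Fact p.Prime] {H : Subgroup G} {y : G} (hy : orderOf y = p)
    (h : y ∉ H) : Disjoint H (Subgroup.zpowers y) := by
  have : Fact (Nat.card (Subgroup.zpowers y)).Prime :=
    ⟨by rw [Nat.card_zpowers, hy]; exact Fact.out⟩
  rw [← Subgroup.subgroupOf_eq_bot]
  refine (H.subgroupOf (Subgroup.zpowers y)).eq_bot_or_eq_top_of_prime_card.resolve_right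
    fun htop => h ?_
  exact Subgroup.subgroupOf_eq_top.1 htop (Subgroup.mem_zpowers y)

theorem exists_mem_sylow_ne_one (P : Sylow p G) (h : Nat.card P ≠ 1) : ∃ x ∈ P, x ≠ 1 := by
  by_contra! hP
  exact h (by rw [(Subgroup.eq_bot_iff_forall (P : Subgroup G)).2 hP, Subgroup.card_bot])

theorem exists_commute_of_mem_normalizer [Fact p.Prime] {H : Subgroup G} [Finite H] {g : G}
    (hgp : orderOf g = p) (hg : g ∈ Subgroup.normalizer (H : Set G))
    (hH : ¬ Nat.card H ≡ 1 [MOD p]) : ∃ x ∈ H, x ≠ 1 ∧ Commute g x := by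
  let g' : Subgroup.normalizer (H : Set G) := ⟨g, hg⟩
  let _ : MulAction (Subgroup.zpowers g') H :=
    MulAction.compHom H (H.normalizerMonoidHom.comp (Subgroup.zpowers g').subtype)
  have hZ : IsPGroup p (Subgroup.zpowers g') :=
    IsPGroup.of_card (n := 1) (by rw [Nat.card_zpowers, Subgroup.orderOf_mk, hgp, pow_one])
  by_contra! hno
  have hfix : ∀ x : MulAction.fixedPoints (Subgroup.zpowers g') H, (x : H) = 1 := fun x => by
    by_contra hx
    have hconj : g * (x : H) * g⁻¹ = (x : H) :=
      congrArg Subtype.val (x.2 ⟨g', Subgroup.mem_zpowers g'⟩)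
    exact hno _ (x : H).2 (fun h => hx (Subtype.ext h)) (mul_inv_eq_iff_eq_mul.1 hconj)
  have : Nat.card (MulAction.fixedPoints (Subgroup.zpowers g') H) = 1 :=
    Nat.card_eq_one_iff_unique.2 ⟨⟨fun x y => Subtype.ext ((hfix x).trans (hfix y).symm)⟩,
      ⟨1, fun z => map_one (H.normalizerMonoidHom z)⟩⟩
  exact hH (this ▸ hZ.card_modEq_card_fixedPoints H)

theorem card_orderOf_three_add_five_lt [Finite G] :
    Nat.card {g : G // orderOf g = 3} + Nat.card {g : G // orderOf g = 5} < Nat.card G := by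
  have : Fintype G := Fintype.ofFinite G
  classical
  simp only [Nat.card_eq_fintype_card, Fintype.card_subtype]
  rw [← Finset.card_union_of_disjoint (Finset.disjoint_filter.2 fun g _ h => by omega)]
  exact Finset.card_lt_univ_of_notMem (x := 1) (by simp)

theorem card_sylow_mul_card_normalizer [Finite G] [Fact p.Prime] (P : Sylow p G) :
    Nat.card (Sylow p G) * Nat.card (Subgroup.normalizer (P : Set G)) = Nat.card G := by
  rw [P.card_eq_index_normalizer, Subgroup.index_mul_card]

theorem mem_normalizer_of_card_sylow_eq_one (h : Nat.card (Sylow p G) = 1) (P : Sylow p G) (g : G) :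
    g ∈ Subgroup.normalizer (P : Set G) :=
  Sylow.smul_eq_iff_mem_normalizer.1 ((Nat.card_eq_one_iff_unique.1 h).1.elim _ _)

theorem smul_sylow_ne {P Q : Sylow p G} (h : P ≠ Q) {x : G} (hx : x ∈ P) :
    x • Q ≠ P := fun hPQ => h <| by
  rw [smul_eq_iff_eq_inv_smul] at hPQ
  rw [hPQ, eq_comm, Sylow.smul_eq_iff_mem_normalizer]
  exact Subgroup.le_normalizer (inv_mem hx)

theorem pow_modEq_one_of_conj_eq_pow {x y : G} {m n : ℕ} (h : y⁻¹ * x * y = x ^ m)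
    (hy : y ^ n = 1) : m ^ n ≡ 1 [MOD orderOf x] := by
  have hiter : ∀ k, (y ^ k)⁻¹ * x * y ^ k = x ^ m ^ k := fun k => by
    induction k with
    | zero => simp
    | succ k ih =>
      calc (y ^ (k + 1))⁻¹ * x * y ^ (k + 1) = y⁻¹ * ((y ^ k)⁻¹ * x * y ^ k) * y := by
            rw [pow_succ]; group
        _ = (y⁻¹ * x * y) ^ m ^ k := by rw [ih]; simpa using (conj_pow (a := y⁻¹)).symm
        _ = x ^ m ^ (k + 1) := by rw [h, ← pow_mul, pow_succ']
  rw [← pow_eq_pow_iff_modEq, ← hiter n, hy]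
  simp

theorem conj_ne_sq_of_delta6 (h6 : delta6.HoldsIn G) {x y : G} (hx : orderOf x = 5) :
    y⁻¹ * x * y ≠ x ^ 2 := by
  intro h
  have hconj : ∀ k : ℕ, y⁻¹ * x ^ k * y = x ^ (2 * k) := fun k => by
    rw [pow_mul, ← h]
    simpa using (conj_pow (a := y⁻¹) (b := x)).symm
  have hne : ∀ {k : ℕ}, ¬ 5 ∣ k → x ^ k ≠ 1 := fun hk h' =>
    hk (hx ▸ orderOf_dvd_of_pow_eq_one h')
  rcases delta6_holdsIn_iff.1 h6 x y with h' | h' | h' | h' | h'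
  · exact hne (by norm_num) h'
  · have := pow_modEq_one_of_conj_eq_pow h h'
    rw [hx] at this
    exact absurd this (by decide)
  · rw [h, ← pow_succ', ← pow_mul] at h'
    exact hne (by norm_num) h'
  · rw [hconj, ← pow_succ', ← pow_mul] at h'
    exact hne (by norm_num) h'
  · rw [h, ← pow_add, ← pow_mul] at h'
    exact hne (by norm_num) h'

theorem conj_eq_self_or_inv_of_delta6 (h6 : delta6.HoldsIn G) {x g : G}
    (hx : orderOf x = 3 ∨ orderOf x = 5) (h : g * x * g⁻¹ ∈ Subgroup.zpowers x) :
    g * x * g⁻¹ = x ∨ g * x * g⁻¹ = x⁻¹ := by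
  classical
  have hfin : IsOfFinOrder x := orderOf_pos_iff.1 (by omega)
  obtain ⟨k, hk, hconj⟩ := Finset.mem_image.1 (hfin.mem_zpowers_iff_mem_range_orderOf.1 h)
  rw [Finset.mem_range] at hk
  have hlast : k + 1 = orderOf x → g * x * g⁻¹ = x⁻¹ := fun hk => by
    rw [← hconj, eq_inv_iff_mul_eq_one, ← pow_succ, hk, pow_orderOf_eq_one]
  have hpos : k ≠ 0 := by
    rintro rfl
    have : x = 1 := by simpa using hconj.symm
    simp [this] at hx
  have hk2 : orderOf x = 5 → k ≠ 2 := by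
    rintro hx5 rfl
    exact conj_ne_sq_of_delta6 h6 (y := g⁻¹) hx5 (by rw [inv_inv, ← hconj])
  have hk3 : orderOf x = 5 → k ≠ 3 := by
    rintro hx5 rfl
    refine conj_ne_sq_of_delta6 h6 (y := g) hx5 ?_
    have h6 : (g * x * g⁻¹) ^ 2 = x := by
      rw [← hconj, ← pow_mul, pow_succ x 5, ← hx5, pow_orderOf_eq_one, one_mul]
    calc g⁻¹ * x * g = g⁻¹ * (g * x * g⁻¹) ^ 2 * g := by rw [h6]
      _ = x ^ 2 := by rw [conj_pow]; group
  obtain rfl | hk1 := eq_or_ne k 1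
  · exact Or.inl (by simpa using hconj.symm)
  · exact Or.inr (hlast (by omega))

theorem eq_three_or_five_of_delta2 (h2 : delta2.HoldsIn G) [Fact p.Prime] (hp : p ≠ 2) {x : G}
    (hx : orderOf x = p) : p = 3 ∨ p = 5 := by
  have hprime : p.Prime := Fact.out
  have hle := orderOf_mem_Icc_of_delta2 h2 x
  rw [hx] at hle
  obtain ⟨h1, h5⟩ := hle
  interval_cases p <;> revert hprime <;> simp_all (decide := true)

theorem pow_eq_one_of_commute_of_delta2 (h2 : delta2.HoldsIn G) [Fact p.Prime] (hp : p ≠ 2)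
    {x y : G} (hx : orderOf x = p) (h : Commute x y) : y ^ p = 1 := by
  rw [← orderOf_dvd_iff_pow_eq_one]
  have hp3 : 3 ≤ p := (Fact.out : p.Prime).two_le.lt_of_ne' hp
  have hy := orderOf_mem_Icc_of_delta2 h2 y
  have hxy := orderOf_mem_Icc_of_delta2 h2 (x * y)
  by_cases hcop : (orderOf x).Coprime (orderOf y)
  · rw [h.orderOf_mul_eq_mul_orderOf_of_coprime hcop, hx] at hxy
    have : orderOf y = 1 := by nlinarith
    exact this ▸ one_dvd p
  · have hdvd : p ∣ orderOf y := by
      rwa [hx, (Fact.out : p.Prime).coprime_iff_not_dvd, not_not] at hcop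
    exact (Nat.eq_of_dvd_of_lt_two_mul (by omega) hdvd (by omega)).dvd

theorem divisors_360 : Nat.divisors 360 = {1, 2, 3, 4, 5, 6, 8, 9, 10, 12, 15, 18, 20, 24, 30, 36,
    40, 45, 60, 72, 90, 120, 180, 360} := by
  decide +kernel

end SylowSubgroups

namespace Satisfies

variable {G : Type v} [Group G] {p : ℕ} [Fact p.Prime] (hG : Satisfies G sevenFormulas)
include hG

theorem finite : Finite G :=
  finite_of_omega (satisfies_sevenFormulas_iff.1 hG).1

theorem delta2 : delta2.HoldsIn G :=
  (satisfies_sevenFormulas_iff.1 hG).2.1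

theorem delta4 : delta4.HoldsIn G :=
  (satisfies_sevenFormulas_iff.1 hG).2.2.2.1

theorem delta6 : delta6.HoldsIn G :=
  (satisfies_sevenFormulas_iff.1 hG).2.2.2.2.2.1

theorem orderOf_of_mem_sylow (hp : p ≠ 2) (P : Sylow p G) {x : G} (hx : x ∈ P) (hx1 : x ≠ 1) :
    orderOf x = p := by
  obtain ⟨k, hk⟩ := IsPGroup.iff_orderOf.1 P.2 ⟨x, hx⟩
  exact orderOf_eq_of_delta2 hG.delta2 hp (by rwa [Subgroup.orderOf_mk] at hk) hx1

theorem card_sylow_dvd_sq (hp : p ≠ 2) (P : Sylow p G) : Nat.card P ∣ p ^ 2 := by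
  have := hG.finite
  have hprime : p.Prime := Fact.out
  obtain ⟨k, hk⟩ := IsPGroup.iff_card.1 P.2
  have hdvd : Nat.card P ∣ 360 := (Subgroup.card_subgroup_dvd_card _).trans hG.card_dvd
  rw [hk] at hdvd ⊢
  refine pow_dvd_pow p ?_
  by_contra! hk3
  have hcube : p ^ 3 ∣ 360 := (pow_dvd_pow p hk3).trans hdvd
  have hp3 : 3 ≤ p := hprime.two_le.lt_of_ne' hp
  have hp8 : p < 8 := lt_of_pow_lt_pow_left₀ 3 (by norm_num)
    ((Nat.le_of_dvd (by norm_num) hcube).trans_lt (by norm_num))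
  interval_cases p <;> omega

theorem commute_of_mem_sylow (hp : p ≠ 2) (P : Sylow p G) {x y : G} (hx : x ∈ P) (hy : y ∈ P) :
    Commute x y := by
  have := hG.finite
  obtain ⟨k, hk2, hk⟩ := (Nat.dvd_prime_pow Fact.out).1 (hG.card_sylow_dvd_sq hp P)
  have hcomm : IsMulCommutative P := by
    interval_cases k
    · have : Subsingleton P := (Nat.card_eq_one_iff_unique.1 (by simpa using hk)).1
      exact ⟨⟨fun a b => Subsingleton.elim _ _⟩⟩
    · have := isCyclic_of_prime_card (hk.trans (pow_one p))
      infer_instance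
    · exact IsPGroup.isMulCommutative_of_card_eq_prime_sq hk
  exact congrArg Subtype.val (hcomm.is_comm.comm (⟨x, hx⟩ : P) ⟨y, hy⟩)

theorem mem_sylow_of_commute (hp : p ≠ 2) (P : Sylow p G) {x y : G} (hx : x ∈ P) (hx1 : x ≠ 1)
    (h : Commute x y) : y ∈ P := by
  have hpow : IsPGroup p (Subgroup.centralizer {x}) := fun g => ⟨1, Subtype.ext (by
    rw [pow_one]
    exact pow_eq_one_of_commute_of_delta2 hG.delta2 hp (hG.orderOf_of_mem_sylow hp P hx hx1)
      (Subgroup.mem_centralizer_singleton_iff.1 g.2).symm)⟩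
  have hcent : Subgroup.centralizer {x} = P := P.is_maximal' hpow fun z hz =>
    Subgroup.mem_centralizer_singleton_iff.2 (hG.commute_of_mem_sylow hp P hz hx)
  exact hcent.le (Subgroup.mem_centralizer_singleton_iff.2 h.symm)

theorem sylow_eq_of_mem (hp : p ≠ 2) {P Q : Sylow p G} {x : G} (hP : x ∈ P) (hQ : x ∈ Q)
    (hx1 : x ≠ 1) : P = Q :=
  SetLike.ext fun _ =>
    ⟨fun hy => hG.mem_sylow_of_commute hp Q hQ hx1 (hG.commute_of_mem_sylow hp P hP hy),
      fun hy => hG.mem_sylow_of_commute hp P hP hx1 (hG.commute_of_mem_sylow hp Q hQ hy)⟩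

theorem conj_eq_inv_of_mem_normalizer (hp : p ≠ 2) (P : Sylow p G) (hP : Nat.card P = p) {x g : G}
    (hx : x ∈ P) (hg : g ∈ Subgroup.normalizer (P : Set G)) (hgP : g ∉ P) :
    g * x * g⁻¹ = x⁻¹ := by
  have := hG.finite
  by_cases hx1 : x = 1
  · simp [hx1]
  have hord := hG.orderOf_of_mem_sylow hp P hx hx1
  have hz : Subgroup.zpowers x = P := Subgroup.eq_of_le_of_card_ge (Subgroup.zpowers_le.2 hx)
    (by rw [Nat.card_zpowers, hord]; exact hP.le)
  have hconj : g * x * g⁻¹ ∈ Subgroup.zpowers x := by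
    rw [hz]
    exact (Subgroup.mem_normalizer_iff.1 hg x).1 hx
  refine (conj_eq_self_or_inv_of_delta6 hG.delta6 ?_ hconj).resolve_left fun h => hgP
    (hG.mem_sylow_of_commute hp P hx hx1 (mul_inv_eq_iff_eq_mul.1 h).symm)
  exact hord ▸ eq_three_or_five_of_delta2 hG.delta2 hp hord

theorem card_normalizer_of_card_eq_prime (hp : p ≠ 2) (P : Sylow p G) (hP : Nat.card P = p) :
    Nat.card (Subgroup.normalizer (P : Set G)) = p ∨
      Nat.card (Subgroup.normalizer (P : Set G)) = 2 * p := by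
  have := hG.finite
  obtain ⟨x, hx, hx1⟩ := exists_mem_sylow_ne_one P (by
    rw [hP]; exact (Fact.out : p.Prime).one_lt.ne')
  let H := (P : Subgroup G).subgroupOf (Subgroup.normalizer (P : Set G))
  have hle : (P : Subgroup G) ≤ Subgroup.normalizer (P : Set G) := Subgroup.le_normalizer
  have hH : Nat.card H = p := (Nat.card_congr (Subgroup.subgroupOfEquivOfLe hle).toEquiv).trans hP
  have hindex : H.index = 1 ∨ H.index = 2 := index_eq_one_or_two_of_mul_mem fun a ha b hb => by
    refine hG.mem_sylow_of_commute hp P hx hx1 (mul_inv_eq_iff_eq_mul.1 ?_).symm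
    calc (a * b : G) * x * (a * b : G)⁻¹ = a * (b * x * (b : G)⁻¹) * (a : G)⁻¹ := by group
      _ = x := by
        rw [hG.conj_eq_inv_of_mem_normalizer hp P hP hx b.2 hb,
          hG.conj_eq_inv_of_mem_normalizer hp P hP (inv_mem hx) a.2 ha, inv_inv]
  rw [← H.card_mul_index, hH]
  rcases hindex with h | h <;> rw [h] <;> omega

theorem card_sylow_mul_le (hp : p ≠ 2) {q : ℕ} (hq : ∀ P : Sylow p G, Nat.card P = q + 1) :
    Nat.card (Sylow p G) * q ≤ Nat.card {g : G // orderOf g = p} := by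
  have := hG.finite
  have hcard : ∀ P : Sylow p G, Nat.card {x : P // x ≠ 1} = q := fun P => by
    have : Fintype P := Fintype.ofFinite P
    classical
    rw [Nat.card_eq_fintype_card, Fintype.card_subtype_compl, Fintype.card_subtype_eq,
      ← Nat.card_eq_fintype_card]
    exact congrArg (· - 1) (hq P)
  have : Fintype (Sylow p G) := Fintype.ofFinite _
  have hsigma : Nat.card (Σ P : Sylow p G, {x : P // x ≠ 1}) = Nat.card (Sylow p G) * q := by
    simp [Nat.card_sigma, hcard]
  have hne : ∀ {P : Sylow p G} (x : {x : P // x ≠ 1}), (x : G) ≠ 1 := fun x h =>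
    x.2 (Subtype.ext h)
  rw [← hsigma]
  refine Nat.card_le_card_of_injective
    (fun a => ⟨(a.2 : G), hG.orderOf_of_mem_sylow hp a.1 a.2.1.2 (hne a.2)⟩) ?_
  rintro ⟨P, x⟩ ⟨Q, y⟩ h
  have hxy : (x : G) = y := congrArg Subtype.val h
  obtain rfl : P = Q := hG.sylow_eq_of_mem hp x.1.2 (hxy ▸ y.1.2) (hne x)
  rw [Subtype.ext (Subtype.ext hxy)]

theorem conj_eq_inv_of_orderOf_eq_two (hp : p ≠ 2) (P : Sylow p G) {t x : G} (ht : orderOf t = 2)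
    (htN : t ∈ Subgroup.normalizer (P : Set G)) (hx : x ∈ P) : t * x * t⁻¹ = x⁻¹ := by
  have htt : t * t = 1 := by rw [← pow_two, ← ht, pow_orderOf_eq_one]
  have hinv : t⁻¹ = t := inv_eq_of_mul_eq_one_right htt
  have hy : t * x * t⁻¹ ∈ P := (Subgroup.mem_normalizer_iff.1 htN x).1 hx
  refine (inv_eq_of_mul_eq_one_right ?_).symm
  by_contra hne
  have hcomm : Commute (x * (t * x * t⁻¹)) t := by
    refine (mul_inv_eq_iff_eq_mul.1 ?_).symm
    calc t * (x * (t * x * t⁻¹)) * t⁻¹ = (t * x * t⁻¹) * ((t * t) * x * (t⁻¹ * t⁻¹)) := by group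
      _ = (t * x * t⁻¹) * x := by simp [hinv, htt]
      _ = x * (t * x * t⁻¹) := (hG.commute_of_mem_sylow hp P hx hy).eq.symm
  refine hp ((hG.orderOf_of_mem_sylow hp P
    (hG.mem_sylow_of_commute hp P (mul_mem hx hy) hne hcomm) ?_).symm.trans ht)
  rintro rfl
  simp at ht

/-- Both involutions invert `P`, so their product centralizes `P` and lies in `P`. -/
theorem eq_of_commute_of_orderOf_eq_two (hp : p ≠ 2) (P : Sylow p G) (hP : Nat.card P ≠ 1)
    {t u : G} (ht : orderOf t = 2) (hu : orderOf u = 2)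
    (htN : t ∈ Subgroup.normalizer (P : Set G)) (huN : u ∈ Subgroup.normalizer (P : Set G))
    (h : Commute t u) : t = u := by
  have ht2 : t ^ 2 = 1 := ht ▸ pow_orderOf_eq_one t
  have hu2 : u ^ 2 = 1 := hu ▸ pow_orderOf_eq_one u
  obtain ⟨x, hx, hx1⟩ := exists_mem_sylow_ne_one P hP
  have htu : t * u ∈ P := by
    refine hG.mem_sylow_of_commute hp P hx hx1 (mul_inv_eq_iff_eq_mul.1 ?_).symm
    calc t * u * x * (t * u)⁻¹ = t * (u * x * u⁻¹) * t⁻¹ := by group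
      _ = x := by
        rw [hG.conj_eq_inv_of_orderOf_eq_two hp P hu huN hx,
          hG.conj_eq_inv_of_orderOf_eq_two hp P ht htN (inv_mem hx), inv_inv]
  by_contra hne
  have hne1 : t * u ≠ 1 := fun h' => hne (by
    rw [mul_eq_one_iff_eq_inv.1 h', inv_eq_iff_mul_eq_one, ← pow_two, hu2])
  refine hp ((hG.orderOf_of_mem_sylow hp P htu hne1).symm.trans ?_)
  exact orderOf_eq_prime (by rw [h.mul_pow, ht2, hu2, one_mul]) hne1

theorem not_eight_dvd_card_normalizer (hp : p ≠ 2) (P : Sylow p G) (hP : Nat.card P ≠ 1) :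
    ¬ 8 ∣ Nat.card (Subgroup.normalizer (P : Set G)) := by
  intro h
  have := hG.finite
  obtain ⟨S, hS⟩ := Sylow.exists_subgroup_card_pow_prime
    (G := Subgroup.normalizer (P : Set G)) 2 (n := 3) h
  have hS2 : IsPGroup 2 S := IsPGroup.of_card hS
  have hGS := (hG.subgroup (Subgroup.normalizer (P : Set G))).subgroup S
  obtain ⟨x, hx⟩ := exists_orderOf_eq_four_of_four_lt_card hGS.delta2
    (satisfies_sevenFormulas_iff.1 hGS).2.2.2.2.1 hS2 (by omega)
  obtain ⟨y, hy⟩ := exists_notMem_zpowers (x := x) (by omega)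
  obtain ⟨hy2, hyx⟩ := inverts_of_notMem_zpowers hGS.delta2 hGS.delta4 hS2 hx hy
  have hxinv : x⁻¹ ^ 2 = x ^ 2 := by
    rw [inv_pow, inv_eq_iff_mul_eq_one, ← pow_add]
    exact orderOf_dvd_iff_pow_eq_one.1 hx.dvd
  have hcomm : Commute (x ^ 2) y := by
    have : SemiconjBy y (x ^ 2) (x⁻¹ ^ 2) := SemiconjBy.pow_right hyx 2
    exact (hxinv ▸ this).symm
  have hx2 : orderOf (x ^ 2) = 2 := by rw [orderOf_pow, hx]; rfl
  have heq : ((x ^ 2 : S) : G) = y := hG.eq_of_commute_of_orderOf_eq_two hp P hP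
    (by simpa only [Subgroup.orderOf_coe] using hx2)
    (by simpa only [Subgroup.orderOf_coe] using hy2) (x ^ 2 : S).1.2 y.1.2
    (congrArg (fun z : S => ((z : Subgroup.normalizer (P : Set G)) : G)) hcomm)
  have heq' : x ^ 2 = y := Subtype.ext (Subtype.ext heq)
  exact hy (heq' ▸ pow_mem (Subgroup.mem_zpowers x) 2)

theorem not_five_dvd_card_normalizer (P : Sylow 3 G) (hP : Nat.card P = 9) :
    ¬ 5 ∣ Nat.card (Subgroup.normalizer (P : Set G)) := by
  intro h
  have := hG.finite
  obtain ⟨⟨g, hgN⟩, hg⟩ := exists_prime_orderOf_dvd_card' 5 h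
  rw [Subgroup.orderOf_mk] at hg
  obtain ⟨x, hx, hx1, hcomm⟩ := exists_commute_of_mem_normalizer hg hgN
    (fun hmod => by rw [hP] at hmod; exact absurd hmod (by decide))
  have hgP := hG.mem_sylow_of_commute (by norm_num) P hx hx1 hcomm.symm
  have := hG.orderOf_of_mem_sylow (by norm_num) P hgP fun h1 => by simp [h1] at hg
  omega

theorem card_normalizer_of_card_eq_nine (P : Sylow 3 G) (hP : Nat.card P = 9) :
    Nat.card (Subgroup.normalizer (P : Set G)) ∈ ({9, 18, 36} : Finset ℕ) := by
  have hdvd : Nat.card P ∣ Nat.card (Subgroup.normalizer (P : Set G)) :=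
    Subgroup.card_dvd_of_le Subgroup.le_normalizer
  have h8 := hG.not_eight_dvd_card_normalizer (by norm_num) P (by omega)
  have h5 := hG.not_five_dvd_card_normalizer P hP
  have h360 := (hG.subgroup (Subgroup.normalizer (P : Set G))).card_dvd
  obtain ⟨k, hk⟩ := hP ▸ hdvd
  have hk40 : k ∈ Nat.divisors 40 := Nat.mem_divisors.2
    ⟨Nat.dvd_of_mul_dvd_mul_left (k := 9) (by norm_num) (hk ▸ h360), by norm_num⟩
  have : Nat.divisors 40 = {1, 2, 4, 5, 8, 10, 20, 40} := by decide
  simp only [this, Finset.mem_insert, Finset.mem_singleton] at hk40 ⊢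
  omega

theorem mem_sylow_of_smul_eq (hp : p ≠ 2) {P Q : Sylow p G} {x : G} (hx : x ∈ P)
    (h : x • Q = Q) : x ∈ Q := by
  by_cases hx1 : x = 1
  · exact hx1 ▸ one_mem Q
  refine mem_sylow_of_mem_normalizer Q (k := 1) ?_ (Sylow.smul_eq_iff_mem_normalizer.1 h)
  rw [pow_one]
  exact orderOf_dvd_iff_pow_eq_one.1 (hG.orderOf_of_mem_sylow hp P hx hx1).dvd

theorem eq_one_of_smul_sylow_eq (hp : p ≠ 2) {P Q : Sylow p G} (hPQ : P ≠ Q) {x : G}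
    (hx : x ∈ P) (h : x • Q = Q) : x = 1 := by
  by_contra hx1
  exact hPQ (hG.sylow_eq_of_mem hp hx (hG.mem_sylow_of_smul_eq hp hx h) hx1)

theorem elim_smul_sylow_injective (hp : p ≠ 2) {P Q : Sylow p G} (h : P ≠ Q) :
    Function.Injective fun o : Option P => o.elim P fun x => (x : G) • Q := by
  rintro (_ | x) (_ | y) hxy
  · rfl
  · exact absurd hxy.symm (smul_sylow_ne h y.2)
  · exact absurd hxy (smul_sylow_ne h x.2)
  · have hstab : ((y : G)⁻¹ * x) • Q = Q := by
      rw [mul_smul, inv_smul_eq_iff]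
      exact hxy
    have hone := hG.eq_one_of_smul_sylow_eq hp h (mul_mem (inv_mem y.2) x.2) hstab
    rw [Subtype.ext (inv_mul_eq_one.1 hone)]

theorem card_sylow_eq_one_or_lt (hp : p ≠ 2) (P : Sylow p G) :
    Nat.card (Sylow p G) = 1 ∨ Nat.card P < Nat.card (Sylow p G) := by
  have := hG.finite
  by_cases h : ∃ Q : Sylow p G, P ≠ Q
  · obtain ⟨Q, hQ⟩ := h
    exact Or.inr (Nat.lt_of_succ_le (Finite.card_option.ge.trans
      (Nat.card_le_card_of_injective _ (hG.elim_smul_sylow_injective hp hQ))))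
  · push Not at h
    exact Or.inl (Nat.card_eq_one_iff_unique.2 ⟨⟨fun a b => (h a).symm.trans (h b)⟩, ⟨P⟩⟩)

theorem card_sylow_of_prime_dvd (hp : p ≠ 2) (h : p ∣ Nat.card G) (hsq : ¬ p ^ 2 ∣ Nat.card G) :
    (Nat.card (Sylow p G) * p = Nat.card G ∨ Nat.card (Sylow p G) * (2 * p) = Nat.card G) ∧
      Nat.card (Sylow p G) * (p - 1) ≤ Nat.card {g : G // orderOf g = p} := by
  have := hG.finite
  have hprime : p.Prime := Fact.out
  obtain ⟨m, hm⟩ := h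
  have hcop : p.Coprime m := (hprime.coprime_iff_not_dvd).2 fun h => hsq (by
    rw [hm, pow_two]
    exact Nat.mul_dvd_mul_left p h)
  have hcard : ∀ P : Sylow p G, Nat.card P = p := fun P => by
    simpa using card_sylow_eq_of_card_eq_mul (k := 1) P (by rw [pow_one, hm]) hcop
  refine ⟨?_, hG.card_sylow_mul_le hp fun P => by
    rw [hcard P, Nat.sub_add_cancel hprime.one_le]⟩
  let P : Sylow p G := default
  rw [← card_sylow_mul_card_normalizer P]
  rcases hG.card_normalizer_of_card_eq_prime hp P (hcard P) with h | h <;> simp [h]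

theorem card_sylow_eq_nine (h : 9 ∣ Nat.card G) (P : Sylow 3 G) : Nat.card P = 9 := by
  have := hG.finite
  obtain ⟨m, hm⟩ := h
  refine card_sylow_eq_of_card_eq_mul (k := 2) P hm
    ((Nat.Prime.coprime_iff_not_dvd Nat.prime_three).2 fun h3 => ?_)
  have : 9 * 3 ∣ 360 := (Nat.mul_dvd_mul_left 9 h3).trans (hm ▸ hG.card_dvd)
  omega

theorem card_sylow_of_nine_dvd (h : 9 ∣ Nat.card G) :
    (Nat.card (Sylow 3 G) * 9 = Nat.card G ∨ Nat.card (Sylow 3 G) * 18 = Nat.card G ∨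
      Nat.card (Sylow 3 G) * 36 = Nat.card G) ∧
      Nat.card (Sylow 3 G) * 8 ≤ Nat.card {g : G // orderOf g = 3} ∧
      (Nat.card (Sylow 3 G) = 1 ∨ 10 ≤ Nat.card (Sylow 3 G)) := by
  have := hG.finite
  let P : Sylow 3 G := default
  have hP := hG.card_sylow_eq_nine h P
  have hone := hG.card_sylow_eq_one_or_lt (by norm_num) P
  refine ⟨?_, hG.card_sylow_mul_le (by norm_num) (hG.card_sylow_eq_nine h), by omega⟩
  have hN := hG.card_normalizer_of_card_eq_nine P hP
  simp only [Finset.mem_insert, Finset.mem_singleton] at hN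
  rw [← card_sylow_mul_card_normalizer P]
  rcases hN with h | h | h <;> simp [h]

theorem card_of_five_dvd (h : 5 ∣ Nat.card G) : Nat.card G = 5 ∨ Nat.card G = 10 ∨
    Nat.card G = 60 ∨ (Nat.card G = 360 ∧ Nat.card (Sylow 3 G) = 10) := by
  have := hG.finite
  have h25 : ¬ 5 ^ 2 ∣ Nat.card G := fun h => by have := h.trans hG.card_dvd; omega
  have hfive := hG.card_sylow_of_prime_dvd (p := 5) (by norm_num) h h25
  have hmod5 : Nat.card (Sylow 5 G) % 5 = 1 := card_sylow_modEq_one 5 G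
  have hmod3 : Nat.card (Sylow 3 G) % 3 = 1 := card_sylow_modEq_one 3 G
  have hcount := card_orderOf_three_add_five_lt (G := G)
  have hthree := hG.card_sylow_of_prime_dvd (p := 3) (by norm_num)
  have hnine := hG.card_sylow_of_nine_dvd
  have hmem := Nat.mem_divisors.2 ⟨hG.card_dvd, by norm_num⟩
  rw [divisors_360] at hmem
  generalize Nat.card G = n at *
  fin_cases hmem <;> omega

theorem card_of_not_five_dvd (h : ¬ 5 ∣ Nat.card G) :
    Nat.card G ≤ 4 ∨ Nat.card G = 6 ∨ Nat.card G = 8 ∨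
    ((Nat.card G = 12 ∨ Nat.card G = 24) ∧ Nat.card (Sylow 3 G) = 4) ∨
    ((Nat.card G = 9 ∨ Nat.card G = 18 ∨ Nat.card G = 36) ∧ Nat.card (Sylow 3 G) = 1) := by
  have := hG.finite
  have hmod3 : Nat.card (Sylow 3 G) % 3 = 1 := card_sylow_modEq_one 3 G
  have hthree := hG.card_sylow_of_prime_dvd (p := 3) (by norm_num)
  have hnine := hG.card_sylow_of_nine_dvd
  have hmem := Nat.mem_divisors.2 ⟨hG.card_dvd, by norm_num⟩
  rw [divisors_360] at hmem
  generalize Nat.card G = n at *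
  fin_cases hmem <;> omega

end Satisfies

local notation "A₆" => alternatingGroup (Fin 6)

section Embedding

variable {G : Type v} [Group G]

theorem isSection_of_sign_eq_one {X : Type*} [Fintype X] [DecidableEq X]
    (hX : Fintype.card X ≤ 6) {φ : G →* Equiv.Perm X} (hφ : Function.Injective φ)
    (hsign : ∀ g, Equiv.Perm.sign (φ g) = 1) : IsSection G A₆ := by
  obtain ⟨f⟩ := Function.Embedding.nonempty_of_card_le (α := X) (β := Fin 6) (by simpa using hX)
  let ε : X ≃ {y : Fin 6 // y ∈ Set.range f} := Equiv.ofInjective f f.injective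
  let ψ : Equiv.Perm X →* Equiv.Perm (Fin 6) := Equiv.Perm.extendDomainHom ε
  have hmem : ∀ g, ψ (φ g) ∈ A₆ := fun g => by
    rw [Equiv.Perm.mem_alternatingGroup]
    exact (Equiv.Perm.sign_extendDomain _ ε).trans (hsign g)
  refine isSection_of_injective (φ := (ψ.comp φ).codRestrict A₆ hmem) ?_
  rw [MonoidHom.injective_codRestrict]
  exact (Equiv.Perm.extendDomainHom_injective ε).comp hφ

/-- Two further points on which odd permutations act by a transposition make the action even. -/
theorem isSection_of_perm_of_card_le_four {X : Type*} [Finite X] (hX : Nat.card X ≤ 4)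
    {φ : G →* Equiv.Perm X} (hφ : Function.Injective φ) : IsSection G A₆ := by
  classical
  have : Fintype X := Fintype.ofFinite X
  let σ : G →* Equiv.Perm ℤˣ := (MulAction.toPermHom ℤˣ ℤˣ).comp (Equiv.Perm.sign.comp φ)
  have hσ : ∀ u : ℤˣ, Equiv.Perm.sign (MulAction.toPermHom ℤˣ ℤˣ u) = u := by decide
  refine isSection_of_sign_eq_one (φ := (Equiv.Perm.sumCongrHom X ℤˣ).comp (φ.prod σ)) ?_ ?_
    fun g => ?_
  · rw [Nat.card_eq_fintype_card] at hX
    simp only [Fintype.card_sum, Fintype.card_units_int]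
    omega
  · exact Equiv.Perm.sumCongrHom_injective.comp fun a b hab => hφ (congrArg Prod.fst hab)
  · calc Equiv.Perm.sign (Equiv.Perm.sumCongr (φ g) (σ g))
        = Equiv.Perm.sign (φ g) * Equiv.Perm.sign (σ g) := Equiv.Perm.sign_sumCongr _ _
      _ = Equiv.Perm.sign (φ g) * Equiv.Perm.sign (φ g) := congrArg _ (hσ _)
      _ = 1 := Int.units_mul_self _

theorem toPermHom_quotient_zpowers_injective {t g : G} (ht : orderOf t = 2)
    (h : ¬ Commute t g) :
    Function.Injective (MulAction.toPermHom G (G ⧸ Subgroup.zpowers t)) := by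
  rw [← MonoidHom.ker_eq_bot_iff, ← Subgroup.normalCore_eq_ker, Subgroup.eq_bot_iff_forall]
  intro x hx
  have hz : ∀ y ∈ (Subgroup.zpowers t).normalCore, y = 1 ∨ y = t := fun y hy => by
    obtain ⟨k, rfl⟩ := Subgroup.mem_zpowers_iff.1 (Subgroup.normalCore_le _ hy)
    rw [← zpow_mod_orderOf, ht]
    rcases Int.emod_two_eq_zero_or_one k with hk | hk <;> simp [hk]
  refine (hz x hx).resolve_right fun hxt => ?_
  rcases hz _ ((Subgroup.normalCore_normal _).conj_mem x hx g) with hconj | hconj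
  · have hx1 : x = 1 := by simpa using hconj
    rw [← hxt, hx1, orderOf_one] at ht
    exact absurd ht (by norm_num)
  · rw [hxt] at hconj
    exact h (mul_inv_eq_iff_eq_mul.1 hconj).symm

theorem isSection_of_not_commute [Finite G] {t g : G} (ht : orderOf t = 2) (h : ¬ Commute t g)
    (hcard : Nat.card G ≤ 8) : IsSection G A₆ := by
  refine isSection_of_perm_of_card_le_four ?_ (toPermHom_quotient_zpowers_injective ht h)
  have hindex := (Subgroup.zpowers t).card_mul_index
  rw [Nat.card_zpowers, ht, Subgroup.index_eq_card] at hindex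
  omega

end Embedding

section Semidirect

variable {N H G G' : Type*} [Group N] [Group H] [Group G] [Group G']

theorem mul_injective_of_coprime {e : N →* G} {f : H →* G} (he : Function.Injective e)
    (hf : Function.Injective f) (h : (Nat.card N).Coprime (Nat.card H)) :
    Function.Injective fun a : N × H => e a.1 * f a.2 := by
  have hdisj : Disjoint e.range f.range := Subgroup.disjoint_of_coprime_natCard (by
    rwa [← Nat.card_congr (MonoidHom.ofInjective he).toEquiv,
      ← Nat.card_congr (MonoidHom.ofInjective hf).toEquiv])
  exact (Subgroup.mul_injective_of_disjoint hdisj).comp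
    ((MonoidHom.rangeRestrict_injective_iff.2 he).prodMap
      (MonoidHom.rangeRestrict_injective_iff.2 hf))

theorem mul_mul_mul_eq_of_semidirect {e : N →* G} {f : H →* G} {μ : H → N → N}
    (hμ : ∀ h n, f h * e n = e (μ h n) * f h) (a b : N × H) :
    e a.1 * f a.2 * (e b.1 * f b.2) = e (a.1 * μ a.2 b.1) * f (a.2 * b.2) := by
  rw [map_mul, map_mul, mul_assoc, ← mul_assoc (f a.2), hμ]
  simp only [mul_assoc]

theorem exists_injective_of_semidirect {e : N →* G} {f : H →* G} {e' : N →* G'} {f' : H →* G'}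
    {μ : H → N → N} (hμ : ∀ h n, f h * e n = e (μ h n) * f h)
    (hμ' : ∀ h n, f' h * e' n = e' (μ h n) * f' h)
    (hbij : Function.Bijective fun a : N × H => e a.1 * f a.2)
    (hinj : Function.Injective fun a : N × H => e' a.1 * f' a.2) :
    ∃ φ : G →* G', Function.Injective φ := by
  let ε : N × H ≃ G := Equiv.ofBijective _ hbij
  let ν (a : N × H) : G' := e' a.1 * f' a.2
  refine ⟨MonoidHom.mk' (fun g => ν (ε.symm g)) fun g g' => ?_, hinj.comp ε.symm.injective⟩
  obtain ⟨a, rfl⟩ := ε.surjective g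
  obtain ⟨b, rfl⟩ := ε.surjective g'
  have hmul : ε a * ε b = ε (a.1 * μ a.2 b.1, a.2 * b.2) := mul_mul_mul_eq_of_semidirect hμ a b
  rw [hmul, ε.symm_apply_apply, ε.symm_apply_apply, ε.symm_apply_apply]
  exact (mul_mul_mul_eq_of_semidirect hμ' a b).symm

theorem pow_mul_map_eq_of_mul_map_eq {e : N →* G} {t : G} {μ : N → N}
    (h : ∀ n, t * e n = e (μ n) * t) (c : ℕ) (n : N) : t ^ c * e n = e (μ^[c] n) * t ^ c := by
  induction c generalizing n with
  | zero => simp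
  | succ c ih =>
    rw [pow_succ, mul_assoc, h, ← mul_assoc, ih, mul_assoc, Function.iterate_succ_apply]

end Semidirect

section ZModHom

variable {G : Type*} [Group G] {n : ℕ} [NeZero n]

/-- The homomorphism `a ↦ x ^ a` on `ℤ/n`, written multiplicatively, for `x` with `x ^ n = 1`. -/
def zmodPowHom (n : ℕ) [NeZero n] (x : G) (hx : x ^ n = 1) : Multiplicative (ZMod n) →* G where
  toFun a := x ^ a.toAdd.val
  map_one' := by simp
  map_mul' a b := by rw [toAdd_mul, ZMod.val_add, ← pow_eq_pow_mod _ hx, pow_add]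

theorem commute_zmodPowHom {x y : G} (hx : x ^ n = 1) (hy : y ^ n = 1) (h : Commute x y)
    (a b : Multiplicative (ZMod n)) : Commute (zmodPowHom n x hx a) (zmodPowHom n y hy b) :=
  h.pow_pow _ _

/-- The homomorphism `(a, b) ↦ x ^ a * y ^ b` on `ℤ/n × ℤ/n`, written multiplicatively, for
commuting `x` and `y` with `x ^ n = y ^ n = 1`. -/
def zmodPowHom₂ (n : ℕ) [NeZero n] (x y : G) (hx : x ^ n = 1) (hy : y ^ n = 1)
    (h : Commute x y) : Multiplicative (ZMod n × ZMod n) →* G :=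
  ((zmodPowHom n x hx).noncommCoprod (zmodPowHom n y hy) (commute_zmodPowHom hx hy h)).comp
    (MulEquiv.prodMultiplicative (ZMod n) (ZMod n)).toMonoidHom

theorem zmodPowHom_injective {x : G} (hx : x ^ n = 1) (hord : orderOf x = n) :
    Function.Injective (zmodPowHom n x hx) := by
  rw [injective_iff_map_eq_one]
  intro a ha
  have hdvd : orderOf x ∣ a.toAdd.val := orderOf_dvd_of_pow_eq_one ha
  rw [hord] at hdvd
  exact (ZMod.val_eq_zero _).1 (Nat.eq_zero_of_dvd_of_lt hdvd (ZMod.val_lt _))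

theorem zmodPowHom_range {x : G} (hx : x ^ n = 1) :
    (zmodPowHom n x hx).range = Subgroup.zpowers x := by
  refine le_antisymm ?_ (Subgroup.zpowers_le.2 ?_)
  · rintro _ ⟨a, rfl⟩
    exact pow_mem (Subgroup.mem_zpowers x) _
  · refine ⟨.ofAdd (1 : ℕ), ?_⟩
    change x ^ (((1 : ℕ) : ZMod n)).val = x
    rw [ZMod.val_natCast, ← pow_eq_pow_mod _ hx, pow_one]

theorem zmodPowHom₂_injective {x y : G} (hx : x ^ n = 1) (hy : y ^ n = 1) (h : Commute x y)
    (hxn : orderOf x = n) (hyn : orderOf y = n)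
    (hdisj : Disjoint (Subgroup.zpowers x) (Subgroup.zpowers y)) :
    Function.Injective (zmodPowHom₂ n x y hx hy h) := by
  have hcoprod : Function.Injective ((zmodPowHom n x hx).noncommCoprod (zmodPowHom n y hy)
      (commute_zmodPowHom hx hy h)) := by
    rw [MonoidHom.noncommCoprod_injective, zmodPowHom_range, zmodPowHom_range]
    exact ⟨zmodPowHom_injective hx hxn, zmodPowHom_injective hy hyn, hdisj⟩
  exact hcoprod.comp (MulEquiv.prodMultiplicative _ _).injective

theorem exists_injective_of_orderOf_eq {N G G' : Type*} [Group N] [Group G] [Group G'] [Finite G]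
    {k : ℕ} {e : N →* G} {e' : N →* G'} {t : G} {t' : G'} {μ : N → N}
    (he : Function.Injective e) (he' : Function.Injective e') (ht : orderOf t = k)
    (ht' : orderOf t' = k) (hμ : ∀ n, t * e n = e (μ n) * t)
    (hμ' : ∀ n, t' * e' n = e' (μ n) * t') (hcop : (Nat.card N).Coprime k)
    (hcard : Nat.card G = Nat.card N * k) : ∃ φ : G →* G', Function.Injective φ := by
  have : NeZero k := ⟨ht ▸ (orderOf_pos t).ne'⟩
  have htk : t ^ k = 1 := ht ▸ pow_orderOf_eq_one t
  have htk' : t' ^ k = 1 := ht' ▸ pow_orderOf_eq_one t'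
  have hcop' : (Nat.card N).Coprime (Nat.card (Multiplicative (ZMod k))) := by simpa using hcop
  refine exists_injective_of_semidirect (e := e) (e' := e') (f := zmodPowHom k t htk)
    (f' := zmodPowHom k t' htk') (μ := fun c => μ^[c.toAdd.val])
    (fun c => pow_mul_map_eq_of_mul_map_eq hμ _) (fun c => pow_mul_map_eq_of_mul_map_eq hμ' _)
    (Function.Injective.bijective_of_nat_card_le
      (mul_injective_of_coprime he (zmodPowHom_injective htk ht) hcop') ?_)
    (mul_injective_of_coprime he' (zmodPowHom_injective htk' ht') hcop')
  simp [hcard]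

end ZModHom

namespace Satisfies

variable {G : Type v} [Group G] (hG : Satisfies G sevenFormulas)
include hG

theorem eq_one_of_forall_smul_sylow_eq {p : ℕ} [Fact p.Prime] (hp : p ≠ 2)
    [Nontrivial (Sylow p G)] {P : Sylow p G} {x : G} (hx : x ∈ P)
    (h : ∀ Q : Sylow p G, x • Q = Q) : x = 1 := by
  obtain ⟨Q, hQ⟩ := exists_ne P
  exact hG.eq_one_of_smul_sylow_eq hp hQ.symm hx (h Q)

/-- The kernel meets every Sylow subgroup trivially, so it commutes with each of them and therefore
lies in each of them. -/
theorem toPermHom_sylow_injective {p : ℕ} [Fact p.Prime] (hp : p ≠ 2)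
    [Nontrivial (Sylow p G)] : Function.Injective (MulAction.toPermHom G (Sylow p G)) := by
  have := hG.finite
  rw [injective_iff_map_eq_one]
  intro k hk
  have hfix : ∀ P : Sylow p G, k • P = P := fun P => DFunLike.congr_fun hk P
  obtain ⟨P, Q, hPQ⟩ := exists_pair_ne (Sylow p G)
  have hP : Nat.card P ≠ 1 := fun h => hPQ (by
    have hQ : Nat.card Q = 1 := (Nat.card_congr (P.equiv Q).toEquiv).symm.trans h
    exact Sylow.ext ((Subgroup.card_eq_one.1 h).trans (Subgroup.card_eq_one.1 hQ).symm))
  obtain ⟨x, hx, hx1⟩ := exists_mem_sylow_ne_one P hP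
  have hcomm : k * x * k⁻¹ * x⁻¹ = 1 := by
    have hkx : k * x * k⁻¹ ∈ P :=
      (Subgroup.mem_normalizer_iff.1 (Sylow.smul_eq_iff_mem_normalizer.1 (hfix P)) x).1 hx
    refine hG.eq_one_of_forall_smul_sylow_eq hp (mul_mem hkx (inv_mem hx)) fun R => ?_
    have hinv : k⁻¹ • x⁻¹ • R = x⁻¹ • R := by rw [inv_smul_eq_iff, hfix]
    rw [mul_smul, mul_smul, mul_smul, hinv, smul_inv_smul, hfix]
  exact hG.eq_one_of_forall_smul_sylow_eq hp
    (hG.mem_sylow_of_commute hp P hx hx1 (mul_inv_eq_iff_eq_mul.1 (mul_inv_eq_one.1 hcomm)).symm)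
    hfix

theorem not_commute_of_orderOf_eq_two {t x : G} (ht : orderOf t = 2) (hx : orderOf x = 3) :
    ¬ Commute t x := fun h => by
  have hdvd := orderOf_dvd_of_pow_eq_one
    (pow_eq_one_of_commute_of_delta2 hG.delta2 (p := 3) (by norm_num) hx h.symm)
  rw [ht] at hdvd
  exact absurd hdvd (by norm_num)

theorem isSection_of_card_le_four (h : Nat.card G ≤ 4) : IsSection G A₆ :=
  have := hG.finite
  isSection_of_perm_of_card_le_four h (φ := MulAction.toPermHom G G) MulAction.toPerm_injective

theorem isSection_of_card_six (h : Nat.card G = 6) : IsSection G A₆ := by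
  have := hG.finite
  obtain ⟨t, ht⟩ := exists_prime_orderOf_dvd_card' (G := G) 2 (by omega)
  obtain ⟨x, hx⟩ := exists_prime_orderOf_dvd_card' (G := G) 3 (by omega)
  exact isSection_of_not_commute ht (hG.not_commute_of_orderOf_eq_two ht hx) (by omega)

theorem isSection_of_card_eight (h : Nat.card G = 8) : IsSection G A₆ := by
  have := hG.finite
  have h2 : IsPGroup 2 G := IsPGroup.of_card (n := 3) h
  obtain ⟨x, hx⟩ := exists_orderOf_eq_four_of_four_lt_card hG.delta2
    (satisfies_sevenFormulas_iff.1 hG).2.2.2.2.1 h2 (by omega)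
  obtain ⟨y, hy⟩ := exists_notMem_zpowers (x := x) (by omega)
  obtain ⟨hy2, hyx⟩ := inverts_of_notMem_zpowers hG.delta2 hG.delta4 h2 hx hy
  refine isSection_of_not_commute hy2 (g := x) (fun hcomm => ?_) h.le
  rw [hcomm.eq, mul_left_inj] at hyx
  have hx2 : x ^ 2 = 1 := by
    rw [pow_two]
    exact mul_eq_one_iff_eq_inv.2 hyx
  have := orderOf_le_of_pow_eq_one (by norm_num) hx2
  omega

theorem isSection_of_card_sylow_three (h : Nat.card (Sylow 3 G) = 4) : IsSection G A₆ := by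
  have := hG.finite
  have : Nontrivial (Sylow 3 G) := Finite.one_lt_card_iff_nontrivial.1 (by omega)
  exact isSection_of_perm_of_card_le_four h.le (hG.toPermHom_sylow_injective (by norm_num))

theorem isSection_of_card_five (h : Nat.card G = 5) : IsSection G A₆ := by
  have := hG.finite
  have : Fintype G := Fintype.ofFinite G
  classical
  refine isSection_of_sign_eq_one (X := G) (by rw [← Nat.card_eq_fintype_card]; omega)
    (φ := MulAction.toPermHom G G) MulAction.toPerm_injective fun g => ?_
  rw [← pow_one (Equiv.Perm.sign _), ← Int.units_pow_eq_pow_mod_two _ 5, ← map_pow, ← map_pow,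
    ← h, pow_card_eq_one', map_one, map_one]

/-- An odd element would yield a subgroup of order `30`. -/
theorem map_eq_one_of_card_sixty (h : Nat.card G = 60) (s : G →* ℤˣ) (g : G) : s g = 1 := by
  have := hG.finite
  have hindex := s.ker.card_mul_index
  rw [Subgroup.index_ker, h] at hindex
  have hrange : Nat.card s.range ≤ 2 := by simpa using Subgroup.card_le_card_group s.range
  have hker := (hG.subgroup s.ker).card_of_five_dvd
  have hcard : Nat.card s.ker = 60 := by
    have : 0 < Nat.card s.range := Nat.card_pos
    interval_cases Nat.card s.range <;> omega
  have htop : s.ker = ⊤ := Subgroup.eq_top_of_card_eq _ (hcard.trans h.symm)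
  exact MonoidHom.mem_ker.1 (htop ▸ Subgroup.mem_top g)

theorem isSection_of_card_sixty (h : Nat.card G = 60) : IsSection G A₆ := by
  have := hG.finite
  have : Fintype (Sylow 5 G) := Fintype.ofFinite _
  classical
  have hfive : Nat.card (Sylow 5 G) = 6 := by
    have hcard := (hG.card_sylow_of_prime_dvd (p := 5) (by norm_num) (by omega) (by omega)).1
    have hmod : Nat.card (Sylow 5 G) % 5 = 1 := card_sylow_modEq_one 5 G
    omega
  have : Nontrivial (Sylow 5 G) := Finite.one_lt_card_iff_nontrivial.1 (by omega)
  exact isSection_of_sign_eq_one (by rw [← Nat.card_eq_fintype_card, hfive])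
    (hG.toPermHom_sylow_injective (p := 5) (by norm_num))
    (hG.map_eq_one_of_card_sixty h (Equiv.Perm.sign.comp _))

theorem isSection_of_card_ten (h : Nat.card G = 10) : IsSection G A₆ := by
  have := hG.finite
  have hone : Nat.card (Sylow 5 G) = 1 := by
    have hcard := (hG.card_sylow_of_prime_dvd (p := 5) (by norm_num) (by omega) (by omega)).1
    have hmod : Nat.card (Sylow 5 G) % 5 = 1 := card_sylow_modEq_one 5 G
    omega
  obtain ⟨t, ht⟩ := exists_prime_orderOf_dvd_card' (G := G) 2 (by omega)
  obtain ⟨x, hx⟩ := exists_prime_orderOf_dvd_card' (G := G) 5 (by omega)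
  obtain ⟨P, hP⟩ := (IsPGroup.of_card (n := 1)
    (by rw [Nat.card_zpowers, hx, pow_one]) : IsPGroup 5 (Subgroup.zpowers x)).exists_le_sylow
  have hinv := hG.conj_eq_inv_of_orderOf_eq_two (by norm_num) P ht
    (mem_normalizer_of_card_sylow_eq_one hone P t) (hP (Subgroup.mem_zpowers x))
  have hx5 : x ^ 5 = 1 := hx ▸ pow_orderOf_eq_one x
  let x' : A₆ := ⟨c[0, 1, 2, 3, 4], by rw [Equiv.Perm.mem_alternatingGroup]; decide⟩
  let t' : A₆ := ⟨c[1, 4] * c[2, 3], by rw [Equiv.Perm.mem_alternatingGroup]; decide⟩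
  obtain ⟨φ, hφ⟩ := exists_injective_of_orderOf_eq (e := zmodPowHom 5 x hx5)
    (e' := zmodPowHom 5 x' (by decide +kernel)) (t' := t') (μ := (·⁻¹))
    (zmodPowHom_injective hx5 hx) (by decide +kernel) ht
    (orderOf_eq_prime (by decide +kernel) (by decide +kernel)) (fun a => by
      rw [map_inv, ← mul_inv_eq_iff_eq_mul]
      change t * x ^ a.toAdd.val * t⁻¹ = (x ^ a.toAdd.val)⁻¹
      rw [← conj_pow, hinv, inv_pow])
    (by decide +kernel) (by rw [Nat.card_eq_fintype_card]; decide) (by simp [h])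
  exact isSection_of_injective hφ

theorem exists_orderOf_eq_four_mem_normalizer {p : ℕ} [Fact p.Prime] (hp : p ≠ 2) (P : Sylow p G)
    (hP : Nat.card P ≠ 1) (h : 4 ∣ Nat.card (Subgroup.normalizer (P : Set G))) :
    ∃ t ∈ Subgroup.normalizer (P : Set G), orderOf t = 4 := by
  have := hG.finite
  by_contra! hno
  obtain ⟨S, hS⟩ := Sylow.exists_subgroup_card_pow_prime
    (G := Subgroup.normalizer (P : Set G)) 2 (n := 2) h
  have hord : ∀ a : S, a ≠ 1 → orderOf ((a : Subgroup.normalizer (P : Set G)) : G) = 2 :=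
    fun a ha => by
      rcases orderOf_cases_of_isPGroup_two ((hG.subgroup _).subgroup S).delta2
        (IsPGroup.of_card hS) a with h1 | h2 | h4
      · exact absurd (orderOf_eq_one_iff.1 h1) ha
      · rwa [Subgroup.orderOf_coe, Subgroup.orderOf_coe]
      · exact absurd (by rwa [Subgroup.orderOf_coe, Subgroup.orderOf_coe]) (hno a a.1.2)
  have : Nontrivial S := Finite.one_lt_card_iff_nontrivial.1 (by omega)
  obtain ⟨x, hx⟩ := exists_ne (1 : S)
  have hx2 := hord x hx
  rw [Subgroup.orderOf_coe, Subgroup.orderOf_coe] at hx2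
  obtain ⟨y, hy⟩ := exists_notMem_zpowers (x := x) (by omega)
  have := IsPGroup.isMulCommutative_of_card_eq_prime_sq hS
  have hxy : ((x : Subgroup.normalizer (P : Set G)) : G) = y :=
    hG.eq_of_commute_of_orderOf_eq_two hp P hP (hord x hx)
      (hord y fun h => hy (h ▸ one_mem _)) x.1.2 y.1.2
      (congrArg (fun z : S => ((z : Subgroup.normalizer (P : Set G)) : G)) (mul_comm' x y))
  have hxy' : x = y := Subtype.ext (Subtype.ext hxy)
  exact hy (hxy' ▸ Subgroup.mem_zpowers x)

theorem exists_hom_of_notMem_zpowers (P : Sylow 3 G) (hP : Nat.card P = 9) {x y : G} (hx : x ∈ P)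
    (hy : y ∈ P) (hx1 : x ≠ 1) (hyx : y ∉ Subgroup.zpowers x) :
    ∃ e : Multiplicative (ZMod 3 × ZMod 3) →* G, Function.Injective e ∧
      e.range = (P : Subgroup G) ∧ ∀ a b, e (.ofAdd (a, b)) = x ^ a.val * y ^ b.val := by
  have := hG.finite
  have hxord := hG.orderOf_of_mem_sylow (by norm_num) P hx hx1
  have hyord := hG.orderOf_of_mem_sylow (by norm_num) P hy fun h => hyx (h ▸ one_mem _)
  let e := zmodPowHom₂ 3 x y (hxord ▸ pow_orderOf_eq_one x) (hyord ▸ pow_orderOf_eq_one y)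
    (hG.commute_of_mem_sylow (by norm_num) P hx hy)
  have he : Function.Injective e := zmodPowHom₂_injective _ _ _ hxord hyord
    (disjoint_zpowers_of_notMem hyord hyx)
  refine ⟨e, he, Subgroup.eq_of_le_of_card_ge ?_ ?_, fun a b => rfl⟩
  · rintro _ ⟨v, rfl⟩
    exact mul_mem (pow_mem hx _) (pow_mem hy _)
  · rw [← Nat.card_congr (MonoidHom.ofInjective he).toEquiv]
    exact hP.le.trans (by simp)

theorem exists_hom_of_card_eq_nine (P : Sylow 3 G) (hP : Nat.card P = 9) :
    ∃ e : Multiplicative (ZMod 3 × ZMod 3) →* G, Function.Injective e ∧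
      e.range = (P : Subgroup G) := by
  obtain ⟨x, hx, hx1⟩ := exists_mem_sylow_ne_one P (by omega)
  have hord : orderOf (⟨x, hx⟩ : P) = 3 := by
    rw [Subgroup.orderOf_mk, hG.orderOf_of_mem_sylow (by norm_num) P hx hx1]
  obtain ⟨y, hy⟩ := exists_notMem_zpowers (x := (⟨x, hx⟩ : P))
    ((hord.trans_lt (by norm_num : 3 < 9)).trans_eq hP.symm)
  obtain ⟨e, he, hrange, -⟩ := hG.exists_hom_of_notMem_zpowers P hP hx y.2 hx1 fun h => hy (by
    obtain ⟨k, hk⟩ := h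
    exact ⟨k, Subtype.ext hk⟩)
  exact ⟨e, he, hrange⟩

theorem conj_conj_eq_inv {p : ℕ} [Fact p.Prime] (hp : p ≠ 2) (P : Sylow p G) {t x : G}
    (htN : t ∈ Subgroup.normalizer (P : Set G)) (ht : orderOf t = 4) (hx : x ∈ P) :
    t * (t * x * t⁻¹) * t⁻¹ = x⁻¹ := by
  have := hG.finite
  have ht2 : orderOf (t ^ 2) = 2 := by rw [orderOf_pow, ht]; rfl
  rw [← hG.conj_eq_inv_of_orderOf_eq_two hp P ht2 (pow_mem htN 2) hx, pow_two]
  group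

theorem conj_notMem_zpowers (P : Sylow 3 G) {t x : G}
    (htN : t ∈ Subgroup.normalizer (P : Set G)) (ht : orderOf t = 4) (hx : x ∈ P) (hx1 : x ≠ 1) :
    t * x * t⁻¹ ∉ Subgroup.zpowers x := by
  intro hmem
  obtain ⟨k, hk⟩ := Subgroup.mem_zpowers_iff.1 hmem
  have hord := hG.orderOf_of_mem_sylow (by norm_num) P hx hx1
  have hinv := hG.conj_conj_eq_inv (by norm_num) P htN ht hx
  rw [← hk, ← conj_zpow, ← hk, ← zpow_mul, eq_inv_iff_mul_eq_one, ← zpow_add_one,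
    ← orderOf_dvd_iff_zpow_eq_one, hord] at hinv
  have hmod : (k : ZMod 3) * k + 1 = 0 := by
    exact_mod_cast (ZMod.intCast_zmod_eq_zero_iff_dvd _ 3).2 hinv
  exact absurd hmod (by generalize (k : ZMod 3) = a; revert a; decide)

end Satisfies

/-- Multiplication by `i` on the field `𝔽₉ = 𝔽₃[i]`, the element `a + b i` being encoded as the
pair `(a, b)`. -/
def mulI (v : ZMod 3 × ZMod 3) : ZMod 3 × ZMod 3 := (-v.2, v.1)

namespace Satisfies

variable {G : Type v} [Group G] (hG : Satisfies G sevenFormulas)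
include hG

theorem exists_hom_of_orderOf_eq_four (P : Sylow 3 G) (hP : Nat.card P = 9) {t : G}
    (htN : t ∈ Subgroup.normalizer (P : Set G)) (ht : orderOf t = 4) :
    ∃ e : Multiplicative (ZMod 3 × ZMod 3) →* G, Function.Injective e ∧
      e.range = (P : Subgroup G) ∧
      ∀ v, t * e (.ofAdd v) = e (.ofAdd (mulI v)) * t := by
  obtain ⟨x, hx, hx1⟩ := exists_mem_sylow_ne_one P (by omega)
  have hy : t * x * t⁻¹ ∈ P := (Subgroup.mem_normalizer_iff.1 htN x).1 hx
  obtain ⟨e, he, hrange, hval⟩ := hG.exists_hom_of_notMem_zpowers P hP hx hy hx1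
    (hG.conj_notMem_zpowers P htN ht hx hx1)
  refine ⟨e, he, hrange, fun ⟨a, b⟩ => mul_inv_eq_iff_eq_mul.1 ?_⟩
  have hx_neg : x ^ (-b).val = (x ^ b.val)⁻¹ := by
    have := map_inv e (.ofAdd (b, 0))
    rwa [← ofAdd_neg, Prod.neg_mk, neg_zero, hval, hval, ZMod.val_zero, pow_zero, mul_one,
      mul_one] at this
  calc t * e (.ofAdd (a, b)) * t⁻¹
      = (t * x ^ a.val * t⁻¹) * (t * (t * x * t⁻¹) ^ b.val * t⁻¹) := by rw [hval]; group
    _ = (t * x * t⁻¹) ^ a.val * (x ^ b.val)⁻¹ := by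
      rw [← conj_pow, ← conj_pow, hG.conj_conj_eq_inv (by norm_num) P htN ht hx, inv_pow]
    _ = x ^ (-b).val * (t * x * t⁻¹) ^ a.val := by
      rw [hx_neg]
      exact (((hG.commute_of_mem_sylow (by norm_num) P hx hy).pow_pow _ _).inv_left).eq.symm
    _ = e (.ofAdd (mulI (a, b))) := (hval _ _).symm

end Satisfies

/-- The Sylow `3`-subgroup of `A₆` generated by two disjoint `3`-cycles, parametrized by `𝔽₉`. -/
def cycleHom : Multiplicative (ZMod 3 × ZMod 3) →* A₆ :=
  zmodPowHom₂ 3 ⟨c[0, 1, 2], by rw [Equiv.Perm.mem_alternatingGroup]; decide⟩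
    ⟨c[3, 4, 5], by rw [Equiv.Perm.mem_alternatingGroup]; decide⟩
    (by decide +kernel) (by decide +kernel) (by unfold Commute SemiconjBy; decide +kernel)

/-- An element of order `4` of `A₆` that normalizes `cycleHom.range` and acts on it as `mulI`. -/
def mulIPerm : A₆ :=
  ⟨c[0, 3] * c[1, 4, 2, 5], by rw [Equiv.Perm.mem_alternatingGroup]; decide⟩

theorem cycleHom_injective : Function.Injective cycleHom := by
  decide +kernel

theorem orderOf_mulIPerm : orderOf mulIPerm = 4 :=
  orderOf_eq_prime_pow (p := 2) (n := 1) (by decide +kernel) (by decide +kernel)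

theorem mulIPerm_mul_cycleHom (v : Multiplicative (ZMod 3 × ZMod 3)) :
    mulIPerm * cycleHom v = cycleHom (.ofAdd (mulI v.toAdd)) * mulIPerm := by
  revert v
  decide +kernel

namespace Satisfies

variable {G : Type v} [Group G] (hG : Satisfies G sevenFormulas)
include hG

theorem isSection_of_card_nine (h : Nat.card G = 9) : IsSection G A₆ := by
  have := hG.finite
  let P : Sylow 3 G := default
  obtain ⟨e, he, -⟩ := hG.exists_hom_of_card_eq_nine P (hG.card_sylow_eq_nine (by omega) P)
  obtain ⟨φ, hφ⟩ := exists_injective_of_orderOf_eq (μ := id) he cycleHom_injective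
    orderOf_one orderOf_one (by simp) (by simp) (by simp) (by simp [h])
  exact isSection_of_injective hφ

theorem isSection_of_card_eighteen (h : Nat.card G = 18) (hone : Nat.card (Sylow 3 G) = 1) :
    IsSection G A₆ := by
  have := hG.finite
  let P : Sylow 3 G := default
  obtain ⟨e, he, hrange⟩ := hG.exists_hom_of_card_eq_nine P (hG.card_sylow_eq_nine (by omega) P)
  obtain ⟨t, ht⟩ := exists_prime_orderOf_dvd_card' (G := G) 2 (by omega)
  have hinv : ∀ v, t * e v = e v⁻¹ * t := fun v => by
    rw [map_inv, ← mul_inv_eq_iff_eq_mul]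
    exact hG.conj_eq_inv_of_orderOf_eq_two (by norm_num) P ht
      (mem_normalizer_of_card_sylow_eq_one hone P t) (hrange.le ⟨v, rfl⟩)
  have hsq : orderOf (mulIPerm ^ 2) = 2 := by
    rw [orderOf_pow, orderOf_mulIPerm]; rfl
  obtain ⟨φ, hφ⟩ := exists_injective_of_orderOf_eq he cycleHom_injective ht hsq hinv
    (by decide +kernel) (by rw [Nat.card_eq_fintype_card]; decide) (by simp [h])
  exact isSection_of_injective hφ

theorem isSection_of_card_thirtySix (h : Nat.card G = 36) (hone : Nat.card (Sylow 3 G) = 1) :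
    IsSection G A₆ := by
  have := hG.finite
  let P : Sylow 3 G := default
  have hP := hG.card_sylow_eq_nine (by omega) P
  have hN : Nat.card (Subgroup.normalizer (P : Set G)) = 36 := by
    rw [← h, ← card_sylow_mul_card_normalizer P, hone, one_mul]
  obtain ⟨t, htN, ht⟩ := hG.exists_orderOf_eq_four_mem_normalizer (by norm_num) P (by omega)
    (by rw [hN]; norm_num)
  obtain ⟨e, he, -, hte⟩ := hG.exists_hom_of_orderOf_eq_four P hP htN ht
  obtain ⟨φ, hφ⟩ := exists_injective_of_orderOf_eq he cycleHom_injective ht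
    orderOf_mulIPerm hte mulIPerm_mul_cycleHom (by rw [Nat.card_eq_fintype_card]; decide)
    (by simp [h])
  exact isSection_of_injective hφ

theorem isSection_of_card_ne (h : Nat.card G ≠ 360) : IsSection G A₆ := by
  by_cases h5 : 5 ∣ Nat.card G
  · rcases hG.card_of_five_dvd h5 with hc | hc | hc | hc
    · exact hG.isSection_of_card_five hc
    · exact hG.isSection_of_card_ten hc
    · exact hG.isSection_of_card_sixty hc
    · exact absurd hc.1 h
  · rcases hG.card_of_not_five_dvd h5 with hc | hc | hc | ⟨-, hc⟩ | ⟨hc | hc | hc, hone⟩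
    · exact hG.isSection_of_card_le_four hc
    · exact hG.isSection_of_card_six hc
    · exact hG.isSection_of_card_eight hc
    · exact hG.isSection_of_card_sylow_three hc
    · exact hG.isSection_of_card_nine hc
    · exact hG.isSection_of_card_eighteen hc hone
    · exact hG.isSection_of_card_thirtySix hc hone

end Satisfies

/-- The projective line over the field `𝔽₉` of `mulI`; `none` is the point at infinity. -/
abbrev TenPoints : Type := Option (ZMod 3 × ZMod 3)

namespace TenPoints

/-- The translation `z ↦ z + 1`. -/
def transl : Equiv.Perm TenPoints := Equiv.optionCongr (Equiv.addLeft (1, 0))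

/-- The rotation `z ↦ i z`. -/
def rot : Equiv.Perm TenPoints where
  toFun := Option.map mulI
  invFun := Option.map fun v => (v.2, -v.1)
  left_inv v := by cases v <;> simp [mulI]
  right_inv v := by cases v <;> simp [mulI]

/-- The map that exchanges `0` and `∞`, turns `rot` into its inverse, and sends `1` and `1 + i`
to given points. -/
def swapFun (a b : TenPoints) : TenPoints → TenPoints
  | none => some (0, 0)
  | some (0, 0) => none
  | some (1, 0) => a
  | some (0, 1) => rot.symm a
  | some (2, 0) => rot.symm (rot.symm a)
  | some (0, 2) => rot a
  | some (1, 1) => b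
  | some (2, 1) => rot.symm b
  | some (2, 2) => rot.symm (rot.symm b)
  | some (1, 2) => rot b

/-- The inversion `z ↦ z⁻¹`. -/
def inversion : Equiv.Perm TenPoints where
  toFun := swapFun (some (1, 0)) (some (2, 1))
  invFun := swapFun (some (1, 0)) (some (2, 1))
  left_inv := by unfold Function.LeftInverse; decide +kernel
  right_inv := by unfold Function.RightInverse Function.LeftInverse; decide +kernel

theorem eq_swapFun {f : TenPoints → TenPoints} (hinf : f none = some (0, 0))
    (hzero : f (some (0, 0)) = none) (hrot : ∀ v, f (rot v) = rot.symm (f v)) :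
    f = swapFun (f (some (1, 0))) (f (some (1, 1))) := by
  have hone := hrot (some (1, 0))
  have hi := hrot (some (0, 1))
  have hone_add_i := hrot (some (1, 1))
  have hneg_one_add_i := hrot (some (2, 1))
  have hneg_i : rot (f (some (1, 0))) = f (some (0, 2)) := by
    rw [← Equiv.eq_symm_apply]; exact hrot (some (0, 2))
  have hone_sub_i : rot (f (some (1, 1))) = f (some (1, 2)) := by
    rw [← Equiv.eq_symm_apply]; exact hrot (some (1, 2))
  funext v
  rcases v with _ | ⟨a, b⟩
  · exact hinf
  · fin_cases a <;> fin_cases b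
    exacts [hzero, hone, hneg_i.symm, rfl, rfl, hone_sub_i.symm,
      hi.trans (congrArg _ hone), hone_add_i, hneg_one_add_i.trans (congrArg _ hone_add_i)]

theorem exists_swapFun_eq_inversion : ∀ a b : TenPoints,
    (∀ v, swapFun a b (swapFun a b v) = v) →
    (∀ i j : Fin 4,
      (∀ v, (transl ∘ rot^[i.1] ∘ swapFun a b ∘ rot^[j.1])^[3] v = v) ∨
      (∀ v, (transl ∘ rot^[i.1] ∘ swapFun a b ∘ rot^[j.1])^[4] v = v) ∨
      (∀ v, (transl ∘ rot^[i.1] ∘ swapFun a b ∘ rot^[j.1])^[5] v = v)) →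
    ∃ j : Fin 4, ∀ v, swapFun a b (rot^[j.1] v) = inversion v := by
  decide +kernel

theorem exists_mul_rot_pow_eq_inversion {σ : Equiv.Perm TenPoints} (hinf : σ none = some (0, 0))
    (hzero : σ (some (0, 0)) = none) (hrot : σ * rot = rot⁻¹ * σ) (hsq : σ ^ 2 = 1)
    (hpow : ∀ i j : ℕ, (transl * (rot ^ i * (σ * rot ^ j))) ^ 3 = 1 ∨
      (transl * (rot ^ i * (σ * rot ^ j))) ^ 4 = 1 ∨
      (transl * (rot ^ i * (σ * rot ^ j))) ^ 5 = 1) :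
    ∃ j : ℕ, σ * rot ^ j = inversion := by
  have hσ := eq_swapFun hinf hzero fun v => Equiv.congr_fun hrot v
  obtain ⟨j, hj⟩ := exists_swapFun_eq_inversion _ _
    (fun v => by rw [← hσ]; exact Equiv.congr_fun ((pow_two σ).symm.trans hsq) v)
    (fun i j => by
      have hcoe : transl ∘ rot^[i.1] ∘ σ ∘ rot^[j.1] =
          ⇑(transl * (rot ^ i.1 * (σ * rot ^ j.1))) := by
        simp only [Equiv.Perm.coe_mul, Equiv.Perm.iterate_eq_pow]
      rw [← hσ, hcoe]
      simp only [Equiv.Perm.iterate_eq_pow]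
      exact (hpow i j).imp Equiv.congr_fun (Or.imp Equiv.congr_fun Equiv.congr_fun))
  refine ⟨j, Equiv.ext fun v => ?_⟩
  rw [← hj, ← hσ, Equiv.Perm.iterate_eq_pow, Equiv.Perm.mul_apply]

end TenPoints

theorem pow_ne_one_of_swap {G α : Type*} [Group G] [MulAction G α] {g : G} {a b : α} (hne : a ≠ b)
    (hab : g • a = b) (hba : g • b = a) {n : ℕ} (hn : Odd n) : g ^ n ≠ 1 := by
  obtain ⟨k, rfl⟩ := hn
  intro h
  have hsq : g ^ 2 ∈ MulAction.stabilizer G a := by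
    rw [MulAction.mem_stabilizer_iff, pow_two, mul_smul, hab, hba]
  have hpow : (g ^ 2) ^ k • a = a := pow_mem hsq k
  have hfix : g ^ (2 * k + 1) • a = b := by rw [pow_succ', mul_smul, pow_mul, hpow, hab]
  rw [h, one_smul] at hfix
  exact hne hfix

namespace Satisfies

variable {G : Type v} [Group G] (hG : Satisfies G sevenFormulas)
include hG

theorem exists_smul_sylow_eq (h : Nat.card (Sylow 3 G) = 10) (h9 : 9 ∣ Nat.card G)
    {P Q R : Sylow 3 G} (hQ : P ≠ Q) (hR : P ≠ R) : ∃ x ∈ P, x • Q = R := by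
  have := hG.finite
  have hbij := (Nat.bijective_iff_injective_and_card _).2
    ⟨hG.elim_smul_sylow_injective (by norm_num) hQ, by
      rw [Finite.card_option, h]
      exact congrArg (· + 1) (hG.card_sylow_eq_nine h9 P)⟩
  obtain ⟨_ | x, hx⟩ := hbij.2 R
  · exact absurd hx hR
  · exact ⟨x, x.2, hx⟩

theorem exists_swap (h : Nat.card (Sylow 3 G) = 10) (h9 : 9 ∣ Nat.card G)
    {P Q : Sylow 3 G} (hPQ : P ≠ Q) : ∃ w : G, w • P = Q ∧ w • Q = P := by
  have := hG.finite
  obtain ⟨R, hR⟩ : ∃ R, R ∉ ({P, Q} : Set (Sylow 3 G)) := by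
    by_contra! hall
    have hle := Set.ncard_insert_le P {Q}
    rw [Set.eq_univ_of_forall hall, Set.ncard_univ, Set.ncard_singleton] at hle
    omega
  rw [Set.mem_insert_iff, Set.mem_singleton_iff, not_or] at hR
  obtain ⟨u, -, hu⟩ := hG.exists_smul_sylow_eq h h9 hR.1 hR.2
  have hne : u • Q ≠ Q := fun hQ => hPQ (by rw [← smul_left_cancel_iff u, hu, hQ])
  obtain ⟨q, hq, hqu⟩ := hG.exists_smul_sylow_eq h h9 hne.symm hPQ.symm
  refine ⟨q * u, ?_, by rw [mul_smul, hqu]⟩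
  rw [mul_smul, hu, Sylow.smul_eq_iff_mem_normalizer]
  exact Subgroup.le_normalizer hq

theorem exists_fixed_sylow {P : Sylow 3 G} (h : Nat.card (Sylow 3 G) = 10) {t : G}
    (ht : orderOf t = 4) (htP : t • P = P) : ∃ Q, P ≠ Q ∧ t • Q = Q := by
  have := hG.finite
  have htwo : IsPGroup 2 (Subgroup.zpowers t) :=
    IsPGroup.of_card (n := 2) (by rw [Nat.card_zpowers, ht]; norm_num)
  have hP : P ∈ MulAction.fixedPoints (Subgroup.zpowers t) (Sylow 3 G) := by
    rintro ⟨_, k, rfl⟩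
    exact zpow_mem (MulAction.mem_stabilizer_iff.2 htP) k
  obtain ⟨Q, hQ, hne⟩ := htwo.exists_fixed_point_of_prime_dvd_card_of_fixed_point (Sylow 3 G)
    (by rw [h]; norm_num) hP
  exact ⟨Q, hne, hQ ⟨t, Subgroup.mem_zpowers t⟩⟩

end Satisfies

/-- Two distinct Sylow `3`-subgroups `P` and `Q`, together with an additive parametrization `e` of
`P` by `𝔽₉`, an element `t` of order `4` that fixes `P` and `Q` and acts on `P` as multiplication
by `i`, and an element `w` that exchanges `P` and `Q`. This is the data needed to identify the
action of `G` on its Sylow `3`-subgroups with the action on the projective line over `𝔽₉`, where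
`P` is the point `∞` and `Q` is the point `0`. -/
structure IsFrame {G : Type*} [Group G] (P Q : Sylow 3 G)
    (e : Multiplicative (ZMod 3 × ZMod 3) →* G) (t w : G) : Prop where
  ne : P ≠ Q
  injective : Function.Injective e
  range_eq : e.range = (P : Subgroup G)
  orderOf_eq : orderOf t = 4
  mul_apply : ∀ v, t * e (.ofAdd v) = e (.ofAdd (mulI v)) * t
  smul_left : t • P = P
  smul_right : t • Q = Q
  swap_left : w • P = Q
  swap_right : w • Q = P

/-- The Sylow `3`-subgroup that corresponds to a point of the projective line over `𝔽₉`. -/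
def sylowOfPoint {G : Type*} [Group G] (P Q : Sylow 3 G)
    (e : Multiplicative (ZMod 3 × ZMod 3) →* G) (o : TenPoints) : Sylow 3 G :=
  o.elim P fun v => e (.ofAdd v) • Q

theorem sylowOfPoint_zero {G : Type*} [Group G] (P Q : Sylow 3 G)
    (e : Multiplicative (ZMod 3 × ZMod 3) →* G) : sylowOfPoint P Q e (some (0, 0)) = Q := by
  change e 1 • Q = Q
  rw [map_one, one_smul]

theorem Satisfies.exists_isFrame {G : Type v} [Group G] (hG : Satisfies G sevenFormulas)
    (hc : Nat.card G = 360) (h10 : Nat.card (Sylow 3 G) = 10) :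
    ∃ (P Q : Sylow 3 G) (e : _) (t w : G), IsFrame P Q e t w := by
  have := hG.finite
  let P : Sylow 3 G := default
  have hP := hG.card_sylow_eq_nine (by omega) P
  have hN : Nat.card (Subgroup.normalizer (P : Set G)) = 36 := by
    have hmul := card_sylow_mul_card_normalizer P
    rw [h10] at hmul
    omega
  obtain ⟨t, htN, ht⟩ := hG.exists_orderOf_eq_four_mem_normalizer (by norm_num) P (by omega)
    (by rw [hN]; norm_num)
  obtain ⟨e, he, hrange, hte⟩ := hG.exists_hom_of_orderOf_eq_four P hP htN ht
  have htP : t • P = P := Sylow.smul_eq_iff_mem_normalizer.2 htN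
  obtain ⟨Q, hPQ, htQ⟩ := hG.exists_fixed_sylow h10 ht htP
  obtain ⟨w, hwP, hwQ⟩ := hG.exists_swap h10 (by omega) hPQ
  exact ⟨P, Q, e, t, w, hPQ, he, hrange, ht, hte, htP, htQ, hwP, hwQ⟩

namespace IsFrame

variable {G : Type v} [Group G] {P Q : Sylow 3 G} {e : Multiplicative (ZMod 3 × ZMod 3) →* G}
  {t w : G} (hF : IsFrame P Q e t w)
include hF

theorem mul_pow (k : ℕ) : IsFrame P Q e t (w * t ^ k) where
  __ := hF
  swap_left := by
    have : t ^ k • P = P := pow_mem (MulAction.mem_stabilizer_iff.2 hF.smul_left) k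
    rw [mul_smul, this, hF.swap_left]
  swap_right := by
    have : t ^ k • Q = Q := pow_mem (MulAction.mem_stabilizer_iff.2 hF.smul_right) k
    rw [mul_smul, this, hF.swap_right]

theorem pow_ne_one {n : ℕ} (hn : Odd n) : w ^ n ≠ 1 :=
  pow_ne_one_of_swap hF.ne hF.swap_left hF.swap_right hn

theorem sq_eq_one (h2 : delta2.HoldsIn G) (h4 : delta4.HoldsIn G) : w ^ 2 = 1 := by
  have hfour : orderOf w ≠ 4 := fun hw => by
    rcases mul_pow_fifteen_of_delta4 h4 hw hF.orderOf_eq with h | h | h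
    · exact (hF.mul_pow 1).pow_ne_one (n := 15) (by decide) (by rwa [pow_one])
    · exact (hF.mul_pow 2).pow_ne_one (by decide) h
    · exact (hF.mul_pow 3).pow_ne_one (by decide) h
  have hodd : ¬ orderOf w ∣ 15 := fun h =>
    hF.pow_ne_one (by decide) (orderOf_dvd_iff_pow_eq_one.1 h)
  rw [← orderOf_dvd_iff_pow_eq_one]
  obtain ⟨hpos, hle⟩ := orderOf_mem_Icc_of_delta2 h2 w
  generalize orderOf w = n at *
  interval_cases n <;> omega

theorem mul_eq_inv_mul (h2 : delta2.HoldsIn G) (h4 : delta4.HoldsIn G) : w * t = t⁻¹ * w := by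
  have hw : w⁻¹ = w := inv_eq_of_mul_eq_one_right (by rw [← pow_two, hF.sq_eq_one h2 h4])
  have hwt := (hF.mul_pow 1).sq_eq_one h2 h4
  rw [pow_one, pow_two] at hwt
  rw [← inv_eq_of_mul_eq_one_right hwt, mul_inv_rev, hw]

theorem apply_mem (v : Multiplicative (ZMod 3 × ZMod 3)) : e v ∈ P := by
  change e v ∈ (P : Subgroup G)
  exact hF.range_eq ▸ MonoidHom.mem_range.2 ⟨v, rfl⟩

theorem sylowOfPoint_injective (hG : Satisfies G sevenFormulas) :
    Function.Injective (sylowOfPoint P Q e) := by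
  have hmap : Function.Injective (Option.map fun v => (⟨e (.ofAdd v), hF.apply_mem _⟩ : P)) :=
    Option.map_injective fun u v huv => hF.injective (congrArg Subtype.val huv)
  convert (hG.elim_smul_sylow_injective (by norm_num) hF.ne).comp hmap using 1
  funext o
  cases o <;> rfl

theorem sylowOfPoint_bijective (hG : Satisfies G sevenFormulas)
    (h10 : Nat.card (Sylow 3 G) = 10) : Function.Bijective (sylowOfPoint P Q e) :=
  have := hG.finite
  (Nat.bijective_iff_injective_and_card _).2
    ⟨hF.sylowOfPoint_injective hG, by rw [h10]; simp [TenPoints]⟩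

theorem smul_sylowOfPoint_transl (o : TenPoints) :
    e (.ofAdd (1, 0)) • sylowOfPoint P Q e o = sylowOfPoint P Q e (TenPoints.transl o) := by
  rcases o with _ | v
  · exact Sylow.smul_eq_iff_mem_normalizer.2 (Subgroup.le_normalizer (hF.apply_mem _))
  · have htransl : TenPoints.transl (some v) = some ((1, 0) + v) := rfl
    simp only [htransl, sylowOfPoint, Option.elim_some, ofAdd_add, map_mul, mul_smul]

theorem smul_sylowOfPoint_rot (o : TenPoints) :
    t • sylowOfPoint P Q e o = sylowOfPoint P Q e (TenPoints.rot o) := by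
  rcases o with _ | v
  · exact hF.smul_left
  · change t • e _ • Q = e (.ofAdd (mulI v)) • Q
    rw [← mul_smul, hF.mul_apply, mul_smul, hF.smul_right]

theorem range_le_of_mem {M : Subgroup G} (hx : e (.ofAdd (1, 0)) ∈ M) (ht : t ∈ M) :
    e.range ≤ M := by
  have hy : e (.ofAdd (0, 1)) ∈ M := by
    have h : e (.ofAdd (0, 1)) = t * e (.ofAdd (1, 0)) * t⁻¹ := by
      rw [hF.mul_apply, mul_inv_cancel_right]
      rfl
    exact h ▸ mul_mem (mul_mem ht hx) (inv_mem ht)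
  rintro _ ⟨⟨a, b⟩, rfl⟩
  have h : (.ofAdd (a, b) : Multiplicative (ZMod 3 × ZMod 3)) =
      .ofAdd (1, 0) ^ a.val * .ofAdd (0, 1) ^ b.val := by
    rw [← ofAdd_nsmul, ← ofAdd_nsmul, ← ofAdd_add]
    simp
  change e (.ofAdd (a, b)) ∈ M
  rw [h, map_mul, map_pow, map_pow]
  exact mul_mem (pow_mem hx _) (pow_mem hy _)

theorem card_eq_360_of_le (hG : Satisfies G sevenFormulas) {M : Subgroup G}
    (hP : Nat.card P = 9) (hPM : (P : Subgroup G) ≤ M) (ht : t ∈ M) (hw : w ∈ M) :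
    Nat.card M = 360 := by
  have := hG.finite
  have hnine := Subgroup.card_dvd_of_le hPM
  have hfour := Subgroup.card_dvd_of_le (Subgroup.zpowers_le.2 ht)
  rw [hP] at hnine
  rw [Nat.card_zpowers, hF.orderOf_eq] at hfour
  have hpos : 0 < Nat.card M := Nat.card_pos
  have hone : Nat.card (Sylow 3 M) ≠ 1 := fun hone => hF.ne <| by
    rw [← hF.swap_left, eq_comm, Sylow.smul_eq_iff_mem_normalizer]
    have hmem := mem_normalizer_of_card_sylow_eq_one hone (P.subtype hPM) ⟨w, hw⟩
    rw [← Sylow.smul_eq_iff_mem_normalizer, Sylow.smul_subtype] at hmem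
    exact Sylow.smul_eq_iff_mem_normalizer.1 (Sylow.subtype_injective hmem)
  by_cases hfive : 5 ∣ Nat.card M
  · have := (hG.subgroup M).card_of_five_dvd hfive
    omega
  · have := (hG.subgroup M).card_of_not_five_dvd hfive
    omega

theorem closure_eq_top (hG : Satisfies G sevenFormulas) (hc : Nat.card G = 360) :
    Subgroup.closure {e (.ofAdd (1, 0)), t, w} = ⊤ := by
  have := hG.finite
  have ht : t ∈ Subgroup.closure {e (.ofAdd (1, 0)), t, w} := Subgroup.subset_closure (by simp)
  have hP := hF.range_le_of_mem (Subgroup.subset_closure (by simp)) ht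
  rw [hF.range_eq] at hP
  refine Subgroup.eq_top_of_card_eq _ ?_
  rw [hc, hF.card_eq_360_of_le hG (hG.card_sylow_eq_nine (by omega) P) hP ht
    (Subgroup.subset_closure (by simp))]

theorem exists_hom_perm (hG : Satisfies G sevenFormulas) (h10 : Nat.card (Sylow 3 G) = 10) :
    ∃ ψ : G →* Equiv.Perm TenPoints, Function.Injective ψ ∧
      ∀ g o o', g • sylowOfPoint P Q e o = sylowOfPoint P Q e o' → ψ g o = o' := by
  have := hG.finite
  have : Nontrivial (Sylow 3 G) := ⟨P, Q, hF.ne⟩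
  let ε : TenPoints ≃ Sylow 3 G := Equiv.ofBijective _ (hF.sylowOfPoint_bijective hG h10)
  refine ⟨(Equiv.permCongrHom ε.symm).toMonoidHom.comp (MulAction.toPermHom G (Sylow 3 G)),
    (Equiv.permCongrHom ε.symm).injective.comp (hG.toPermHom_sylow_injective (by norm_num)),
    fun g o o' h => ε.symm_apply_eq.2 h⟩

end IsFrame

theorem Satisfies.exists_injective_range_eq {G : Type v} [Group G] (hG : Satisfies G sevenFormulas)
    (hc : Nat.card G = 360) :
    ∃ ψ : G →* Equiv.Perm TenPoints, Function.Injective ψ ∧ ψ.range =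
      Subgroup.closure {TenPoints.transl, TenPoints.rot, TenPoints.inversion} := by
  have h10 : Nat.card (Sylow 3 G) = 10 := by
    have := hG.card_of_five_dvd (by omega)
    omega
  obtain ⟨P, Q, e, t, w, hF⟩ := hG.exists_isFrame hc h10
  obtain ⟨ψ, hinj, hψ⟩ := hF.exists_hom_perm hG h10
  have htransl : ψ (e (.ofAdd (1, 0))) = TenPoints.transl :=
    Equiv.ext fun o => hψ _ _ _ (hF.smul_sylowOfPoint_transl o)
  have hrot : ψ t = TenPoints.rot := Equiv.ext fun o => hψ _ _ _ (hF.smul_sylowOfPoint_rot o)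
  have hzero : sylowOfPoint P Q e (some (0, 0)) = Q := sylowOfPoint_zero P Q e
  obtain ⟨j, hj⟩ := TenPoints.exists_mul_rot_pow_eq_inversion (σ := ψ w)
    (hψ _ _ _ (hF.swap_left.trans hzero.symm)) (hψ _ _ _ (by rw [hzero]; exact hF.swap_right))
    (by rw [← hrot, ← map_mul, hF.mul_eq_inv_mul hG.delta2 hG.delta4, map_mul, map_inv])
    (by rw [← map_pow, hF.sq_eq_one hG.delta2 hG.delta4, map_one])
    (fun i j => by
      simp only [← htransl, ← hrot, ← map_mul, ← map_pow, map_eq_one_iff ψ hinj]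
      exact delta2_holdsIn_iff.1 hG.delta2 _)
  refine ⟨ψ, hinj, ?_⟩
  rw [MonoidHom.range_eq_map, ← (hF.mul_pow j).closure_eq_top hG hc, MonoidHom.map_closure,
    Set.image_insert_eq, Set.image_pair, map_mul, map_pow, htransl, hrot, hj]

local notation "S₆" => Equiv.Perm (Fin 6)

namespace PermCode

open Equiv.Perm

/-- The number with base `8` digits `a, b, c, d, e, f`, least significant first; it encodes the map
`0 ↦ a, …, 5 ↦ f` in the exhaustive searches below, which the kernel can then run with its built-in
arithmetic. -/
def enc (a b c d e f : ℕ) : ℕ := a + 8 * b + 64 * c + 512 * d + 4096 * e + 32768 * f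

/-- The image of `i` under the map encoded by `x`. -/
def digit (x i : ℕ) : ℕ := Nat.mod (Nat.div x (Nat.pow 8 i)) 8

/-- The code of the composition of the maps encoded by `x` and `y`. -/
def mul (x y : ℕ) : ℕ :=
  enc (digit x (digit y 0)) (digit x (digit y 1)) (digit x (digit y 2)) (digit x (digit y 3))
    (digit x (digit y 4)) (digit x (digit y 5))

/-- The code of the `n`-th iterate of the map encoded by `x`. -/
def pow (x : ℕ) : ℕ → ℕ
  | 0 => enc 0 1 2 3 4 5
  | n + 1 => mul (pow x n) x

/-- The code of a permutation of six points. -/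
def code (σ : S₆) : ℕ := enc (σ 0) (σ 1) (σ 2) (σ 3) (σ 4) (σ 5)

theorem digit_enc {a b c d e f : ℕ} (ha : a < 8) (hb : b < 8) (hc : c < 8) (hd : d < 8)
    (he : e < 8) (hf : f < 8) : digit (enc a b c d e f) 0 = a ∧ digit (enc a b c d e f) 1 = b ∧
    digit (enc a b c d e f) 2 = c ∧ digit (enc a b c d e f) 3 = d ∧
    digit (enc a b c d e f) 4 = e ∧ digit (enc a b c d e f) 5 = f := by
  have h : ∀ x i, digit x i = x / 8 ^ i % 8 := fun _ _ => rfl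
  simp only [h, enc]
  omega

theorem digit_code (σ : S₆) (i : Fin 6) : digit (code σ) i = σ i := by
  have hlt (j : Fin 6) : (σ j : ℕ) < 8 := (σ j).2.trans (by norm_num)
  obtain ⟨h0, h1, h2, h3, h4, h5⟩ := digit_enc (hlt 0) (hlt 1) (hlt 2) (hlt 3) (hlt 4) (hlt 5)
  fin_cases i
  exacts [h0, h1, h2, h3, h4, h5]

theorem code_mul (σ τ : S₆) : code (σ * τ) = mul (code σ) (code τ) := by
  have h (i : Fin 6) : digit (code σ) (digit (code τ) i) = (σ * τ) i := by
    rw [digit_code, digit_code, mul_apply]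
  change enc _ _ _ _ _ _ = enc _ _ _ _ _ _
  congr 1
  exacts [(h 0).symm, (h 1).symm, (h 2).symm, (h 3).symm, (h 4).symm, (h 5).symm]

theorem code_pow (σ : S₆) (n : ℕ) : code (σ ^ n) = pow (code σ) n := by
  induction n with
  | zero => rfl
  | succ n ih => rw [pow_succ, code_mul, ih, pow]

theorem code_injective : Function.Injective code := fun σ τ h => by
  ext i
  rw [← digit_code, ← digit_code, h]

/-- Whether `x` is the code of the identity. -/
def isId (x : ℕ) : Bool := Nat.beq x (enc 0 1 2 3 4 5)

theorem beq_code {σ τ : S₆} : Nat.beq (code σ) (code τ) = true ↔ σ = τ := by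
  rw [Nat.beq_eq, code_injective.eq_iff]

theorem isId_code {σ : S₆} : isId (code σ) = true ↔ σ = 1 := beq_code (τ := 1)

/-- A sufficient condition for the `k`-th power of the permutation with code `x` to be trivial. It
is also necessary for even permutations, as these have order at most five. -/
def powEqOne (k x : ℕ) : Bool :=
  [3, 4, 5, 2].any fun n => Nat.beq (Nat.mod k n) 0 && isId (pow x n)

theorem pow_eq_one_of_powEqOne {k : ℕ} {σ : S₆} (h : powEqOne k (code σ) = true) : σ ^ k = 1 := by
  obtain ⟨n, -, hn⟩ := List.any_eq_true.1 h
  rw [Bool.and_eq_true, Nat.beq_eq, ← code_pow, isId_code] at hn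
  obtain ⟨m, rfl⟩ := Nat.dvd_of_mod_eq_zero hn.1
  rw [pow_mul, hn.2, one_pow]

/-- Whether the number of inversions of the word `a, b, c, d, e, f` is odd. -/
def isOdd (a b c d e f : ℕ) : Bool :=
  Nat.blt b a ^^ Nat.blt c a ^^ Nat.blt d a ^^ Nat.blt e a ^^ Nat.blt f a ^^ Nat.blt c b ^^
    Nat.blt d b ^^ Nat.blt e b ^^ Nat.blt f b ^^ Nat.blt d c ^^ Nat.blt e c ^^ Nat.blt f c ^^
    Nat.blt e d ^^ Nat.blt f d ^^ Nat.blt f e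

/-- The sign of a permutation with an odd (`true`) or even (`false`) number of inversions. -/
def signOf (b : Bool) : ℤˣ := bif b then -1 else 1

theorem signOf_xor : ∀ a b : Bool, signOf (a ^^ b) = signOf a * signOf b := by decide

theorem sign_eq_signOf_isOdd (σ : S₆) :
    sign σ = signOf (isOdd (σ 0) (σ 1) (σ 2) (σ 3) (σ 4) (σ 5)) := by
  have hblt (i j : Fin 6) (hij : i < j) :
      (if σ i < σ j then 1 else -1) = signOf (Nat.blt (σ j) (σ i)) := by
    have hne : σ i ≠ σ j := fun h => hij.ne (σ.injective h)
    rcases lt_or_gt_of_ne hne with h | h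
    · have hf : Nat.blt (σ j) (σ i) = false := by
        rw [Bool.eq_false_iff, Ne, Nat.blt_eq]
        omega
      rw [if_pos h, hf]; rfl
    · have ht : Nat.blt (σ j) (σ i) = true := by rwa [Nat.blt_eq]
      rw [if_neg h.not_gt, ht]; rfl
  have hprod : sign σ = ∏ i, ∏ j > i, signOf (Nat.blt (σ j) (σ i)) :=
    (sign_eq_prod_prod_Ioi σ).trans <| Finset.prod_congr rfl fun i _ =>
      Finset.prod_congr rfl fun j hj => hblt i j (Finset.mem_Ioi.1 hj)
  have hIoi (i : Fin 6) : Finset.Ioi i = Finset.univ.filter (i < ·) := by ext; simp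
  rw [hprod, isOdd]
  simp only [signOf_xor, hIoi, Finset.prod_filter, Fin.prod_univ_six]
  simp [mul_assoc]

/-- The entries of `l` other than `a`. -/
def without (l : List ℕ) (a : ℕ) : List ℕ := l.filter fun b => !Nat.beq b a

/-- The codes of the even permutations. -/
def evenCodes : List ℕ :=
  let l := List.range 6
  l.flatMap fun a =>
  let l := without l a
  l.flatMap fun b =>
  let l := without l b
  l.flatMap fun c =>
  let l := without l c
  l.flatMap fun d =>
  let l := without l d
  l.flatMap fun e =>
  let l := without l e
  l.flatMap fun f => bif isOdd a b c d e f then [] else [enc a b c d e f]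

theorem code_mem_evenCodes {σ : S₆} (hσ : sign σ = 1) : code σ ∈ evenCodes := by
  have hne (i j : Fin 6) (hij : i ≠ j) : Nat.beq (σ i) (σ j) = false := by
    rw [Bool.eq_false_iff, Ne, Nat.beq_eq]
    exact fun h => hij (σ.injective (Fin.ext h))
  have heven : isOdd (σ 0) (σ 1) (σ 2) (σ 3) (σ 4) (σ 5) = false := by
    rw [sign_eq_signOf_isOdd] at hσ
    exact Bool.eq_false_iff.2 fun h => absurd hσ (by rw [h]; decide)
  simp only [evenCodes, List.mem_flatMap]
  refine ⟨σ 0, ?_, σ 1, ?_, σ 2, ?_, σ 3, ?_, σ 4, ?_, σ 5, ?_,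
    by rw [heven]; exact List.mem_singleton_self _⟩
  all_goals simp [without, hne]

theorem of_all_evenCodes {p : ℕ → Bool} (h : evenCodes.all p = true) {σ : S₆} (hσ : sign σ = 1) :
    p (code σ) = true :=
  List.all_eq_true.1 h _ (code_mem_evenCodes hσ)

end PermCode

namespace SixPoints

open Equiv.Perm PermCode

section CycleType

theorem cycleType_of_sign_eq_one {σ : S₆} (hσ : sign σ = 1) : σ.cycleType = 0 ∨
    σ.cycleType = {3} ∨ σ.cycleType = {3, 3} ∨ σ.cycleType = {2, 2} ∨ σ.cycleType = {4, 2} ∨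
    σ.cycleType = {5} := by
  have htwo : ∀ n ∈ σ.cycleType, 2 ≤ n := fun _ => two_le_of_mem_cycleType
  have hsum : σ.cycleType.sum ≤ 6 := by simpa using sum_cycleType_le σ
  have hcard : σ.cycleType.card ≤ 3 := by
    have := Multiset.card_nsmul_le_sum htwo
    rw [smul_eq_mul] at this
    omega
  rw [sign_of_cycleType] at hσ
  generalize σ.cycleType = s at *
  interval_cases hs : s.card
  · exact Or.inl (Multiset.card_eq_zero.1 hs)
  · obtain ⟨a, rfl⟩ := Multiset.card_eq_one.1 hs
    simp only [Multiset.mem_singleton, forall_eq, Multiset.sum_singleton] at htwo hsum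
    interval_cases a <;> revert hσ <;> decide
  · obtain ⟨a, b, rfl⟩ := Multiset.card_eq_two.1 hs
    have ha := htwo a (by simp)
    have hb := htwo b (by simp)
    rw [Multiset.sum_pair] at hsum
    have : a ≤ 4 := by omega
    have : b ≤ 4 := by omega
    interval_cases a <;> interval_cases b <;> first | omega | (revert hσ; decide)
  · obtain ⟨a, b, c, rfl⟩ := Multiset.card_eq_three.1 hs
    have ha := htwo a (by simp)
    have hb := htwo b (by simp)
    have hc := htwo c (by simp)
    simp only [Multiset.insert_eq_cons, Multiset.sum_cons, Multiset.sum_singleton] at hsum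
    obtain rfl : a = 2 := by omega
    obtain rfl : b = 2 := by omega
    obtain rfl : c = 2 := by omega
    revert hσ; decide

theorem pow_eq_one_of_cycleType {σ : S₆} {s : Multiset ℕ} (h : σ.cycleType = s) {n : ℕ}
    (hn : s.lcm ∣ n) : σ ^ n = 1 :=
  orderOf_dvd_iff_pow_eq_one.1 (by rwa [← lcm_cycleType, h])

theorem pow_cases {σ : S₆} (hσ : sign σ = 1) : σ ^ 3 = 1 ∨ σ ^ 4 = 1 ∨ σ ^ 5 = 1 := by
  rcases cycleType_of_sign_eq_one hσ with h | h | h | h | h | h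
  · exact .inl (pow_eq_one_of_cycleType h (by decide))
  · exact .inl (pow_eq_one_of_cycleType h (by decide))
  · exact .inl (pow_eq_one_of_cycleType h (by decide))
  · exact .inr (.inl (pow_eq_one_of_cycleType h (by decide)))
  · exact .inr (.inl (pow_eq_one_of_cycleType h (by decide)))
  · exact .inr (.inr (pow_eq_one_of_cycleType h (by decide)))

theorem cycleType_of_pow_twelve_ne_one {σ : S₆} (hσ : sign σ = 1) (h : σ ^ 12 ≠ 1) :
    σ.cycleType = {5} := by
  rcases cycleType_of_sign_eq_one hσ with hc | hc | hc | hc | hc | hc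
  iterate 5 exact absurd (pow_eq_one_of_cycleType hc (by decide)) h
  exact hc

theorem cycleType_of_pow_thirty_ne_one {σ : S₆} (hσ : sign σ = 1) (h : σ ^ 30 ≠ 1) :
    σ.cycleType = {4, 2} := by
  rcases cycleType_of_sign_eq_one hσ with hc | hc | hc | hc | hc | hc
  iterate 4 exact absurd (pow_eq_one_of_cycleType hc (by decide)) h
  · exact hc
  · exact absurd (pow_eq_one_of_cycleType hc (by decide)) h

theorem cycleType_of_pow_twenty_ne_one {σ : S₆} (hσ : sign σ = 1) (h : σ ^ 20 ≠ 1) :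
    σ.cycleType = {3} ∨ σ.cycleType = {3, 3} := by
  rcases cycleType_of_sign_eq_one hσ with hc | hc | hc | hc | hc | hc
  · exact absurd (pow_eq_one_of_cycleType hc (by decide)) h
  · exact .inl hc
  · exact .inr hc
  iterate 3 exact absurd (pow_eq_one_of_cycleType hc (by decide)) h

theorem cycleType_of_pow_fifteen_ne_one {σ : S₆} (hσ : sign σ = 1) (h : σ ^ 15 ≠ 1) :
    σ.cycleType = {2, 2} ∨ σ.cycleType = {4, 2} := by
  rcases cycleType_of_sign_eq_one hσ with hc | hc | hc | hc | hc | hc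
  iterate 3 exact absurd (pow_eq_one_of_cycleType hc (by decide)) h
  · exact .inl hc
  · exact .inr hc
  · exact absurd (pow_eq_one_of_cycleType hc (by decide)) h

theorem exists_conj_eq {σ τ : S₆} (h : σ.cycleType = τ.cycleType) :
    ∃ c : S₆, MulAut.conj c σ = τ :=
  isConj_iff.1 (isConj_of_cycleType_eq h)

theorem sign_conj {σ : S₆} (hσ : sign σ = 1) (c : S₆) : sign (MulAut.conj c σ) = 1 := by
  simp [hσ]

end CycleType

section Representatives

/-- A permutation of cycle type `(5)`. -/
def five : S₆ := c[0, 1, 2, 3, 4]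

/-- A permutation of cycle type `(4, 2)`. -/
def fourTwo : S₆ := c[0, 1, 2, 3] * c[4, 5]

/-- A permutation of cycle type `(2, 2)`. -/
def twoTwo : S₆ := c[0, 1] * c[2, 3]

/-- A permutation of cycle type `(3)`. -/
def three : S₆ := c[0, 1, 2]

/-- A permutation of cycle type `(3, 3)`. -/
def threeThree : S₆ := c[0, 1, 2] * c[3, 4, 5]

theorem cycleType_five : five.cycleType = {5} := by decide +kernel
theorem cycleType_fourTwo : fourTwo.cycleType = {4, 2} := by decide +kernel
theorem cycleType_twoTwo : twoTwo.cycleType = {2, 2} := by decide +kernel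
theorem cycleType_three : three.cycleType = {3} := by decide +kernel
theorem cycleType_threeThree : threeThree.cycleType = {3, 3} := by decide +kernel

theorem code_five : code five = enc 1 2 3 4 0 5 := by decide
theorem code_fourTwo : code fourTwo = enc 1 2 3 0 5 4 := by decide
theorem code_twoTwo : code twoTwo = enc 1 0 3 2 4 5 := by decide
theorem code_three : code three = enc 1 2 0 3 4 5 := by decide
theorem code_threeThree : code threeThree = enc 1 2 0 4 5 3 := by decide

end Representatives

theorem delta7_five {b : S₆} (hb : sign b = 1) :
    b ^ 12 = 1 ∨ (five * b) ^ 12 = 1 ∨ (five * b ^ 2) ^ 12 = 1 ∨ (five * b ^ 3) ^ 12 = 1 ∨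
      (five * b ^ 4) ^ 12 = 1 := by
  let r := enc 1 2 3 4 0 5
  let p (b : ℕ) : Bool := powEqOne 12 b || (powEqOne 12 (mul r b) ||
    (powEqOne 12 (mul r (pow b 2)) || (powEqOne 12 (mul r (pow b 3)) ||
      powEqOne 12 (mul r (pow b 4)))))
  have h : p (code b) = true := of_all_evenCodes (by decide +kernel) hb
  simp only [p, r, ← code_five, ← code_mul, ← code_pow, Bool.or_eq_true] at h
  have h12 {w : S₆} : powEqOne 12 (code w) = true → w ^ 12 = 1 := pow_eq_one_of_powEqOne
  exact h.imp h12 (.imp h12 (.imp h12 (.imp h12 h12)))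

theorem delta7_perm {a b : S₆} (ha : sign a = 1) (hb : sign b = 1) :
    a ^ 12 = 1 ∨ b ^ 12 = 1 ∨ (a * b) ^ 12 = 1 ∨
      (a * b ^ 2) ^ 12 = 1 ∨ (a * b ^ 3) ^ 12 = 1 ∨ (a * b ^ 4) ^ 12 = 1 := by
  refine or_iff_not_imp_left.2 fun h => ?_
  obtain ⟨c, hc⟩ :=
    exists_conj_eq ((cycleType_of_pow_twelve_ne_one ha h).trans cycleType_five.symm)
  simpa only [← hc, ← map_mul, ← map_pow, EmbeddingLike.map_eq_one_iff]
    using delta7_five (sign_conj hb c)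

theorem delta4_fourTwo {b : S₆} (hb : sign b = 1) :
    b ^ 30 = 1 ∨ (fourTwo * b) ^ 15 = 1 ∨ (fourTwo * b ^ 2) ^ 15 = 1 ∨
      (fourTwo * b ^ 3) ^ 15 = 1 := by
  let r := enc 1 2 3 0 5 4
  let p (b : ℕ) : Bool := powEqOne 30 b || (powEqOne 15 (mul r b) ||
    (powEqOne 15 (mul r (pow b 2)) || powEqOne 15 (mul r (pow b 3))))
  have h : p (code b) = true := of_all_evenCodes (by decide +kernel) hb
  simp only [p, r, ← code_fourTwo, ← code_mul, ← code_pow, Bool.or_eq_true] at h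
  have h15 {w : S₆} : powEqOne 15 (code w) = true → w ^ 15 = 1 := pow_eq_one_of_powEqOne
  exact h.imp pow_eq_one_of_powEqOne (.imp h15 (.imp h15 h15))

theorem delta4_perm {a b : S₆} (ha : sign a = 1) (hb : sign b = 1) :
    a ^ 30 = 1 ∨ b ^ 30 = 1 ∨ (a * b) ^ 15 = 1 ∨
      (a * b ^ 2) ^ 15 = 1 ∨ (a * b ^ 3) ^ 15 = 1 := by
  refine or_iff_not_imp_left.2 fun h => ?_
  obtain ⟨c, hc⟩ :=
    exists_conj_eq ((cycleType_of_pow_thirty_ne_one ha h).trans cycleType_fourTwo.symm)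
  simpa only [← hc, ← map_mul, ← map_pow, EmbeddingLike.map_eq_one_iff]
    using delta4_fourTwo (sign_conj hb c)

theorem delta6_five {b : S₆} (hb : sign b = 1) :
    b ^ 30 = 1 ∨ (five * (b⁻¹ * five * b)) ^ 12 = 1 ∨
      (five * (b⁻¹ * five ^ 3 * b)) ^ 12 = 1 ∨ (five ^ 2 * (b⁻¹ * five * b)) ^ 12 = 1 := by
  refine or_iff_not_imp_left.2 fun h30 => ?_
  have hinv : b⁻¹ = b ^ 3 := by
    rw [inv_eq_iff_mul_eq_one, ← pow_succ']
    exact pow_eq_one_of_cycleType (cycleType_of_pow_thirty_ne_one hb h30) (by decide)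
  let r := enc 1 2 3 4 0 5
  let p (b : ℕ) : Bool := powEqOne 30 b || (powEqOne 12 (mul r (mul (mul (pow b 3) r) b)) ||
    (powEqOne 12 (mul r (mul (mul (pow b 3) (pow r 3)) b)) ||
      powEqOne 12 (mul (pow r 2) (mul (mul (pow b 3) r) b))))
  have h : p (code b) = true := of_all_evenCodes (by decide +kernel) hb
  simp only [p, r, ← code_five, ← code_mul, ← code_pow, Bool.or_eq_true, ← hinv] at h
  have h12 {w : S₆} : powEqOne 12 (code w) = true → w ^ 12 = 1 := pow_eq_one_of_powEqOne
  exact (h.resolve_left fun h => h30 (pow_eq_one_of_powEqOne h)).imp h12 (.imp h12 h12)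

theorem delta6_perm {a b : S₆} (ha : sign a = 1) (hb : sign b = 1) :
    a ^ 12 = 1 ∨ b ^ 30 = 1 ∨ (a * (b⁻¹ * a * b)) ^ 12 = 1 ∨
      (a * (b⁻¹ * a ^ 3 * b)) ^ 12 = 1 ∨ (a ^ 2 * (b⁻¹ * a * b)) ^ 12 = 1 := by
  refine or_iff_not_imp_left.2 fun h => ?_
  obtain ⟨c, hc⟩ :=
    exists_conj_eq ((cycleType_of_pow_twelve_ne_one ha h).trans cycleType_five.symm)
  simpa only [← hc, ← map_mul, ← map_pow, ← map_inv, EmbeddingLike.map_eq_one_iff]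
    using delta6_five (sign_conj hb c)

section Delta3

/-- The codes of the even permutations `b` such that none of `b`, `rb`, `rb²` has its `20`-th power
trivial, where `r` is given by its code. -/
def delta3Codes (r : ℕ) : List ℕ :=
  evenCodes.filter fun b =>
    !(powEqOne 20 b || (powEqOne 20 (mul r b) || powEqOne 20 (mul r (pow b 2))))

theorem code_mem_delta3Codes {a b : S₆} (hb : sign b = 1) (h : b ^ 20 ≠ 1)
    (hab : (a * b) ^ 20 ≠ 1) (hab2 : (a * b ^ 2) ^ 20 ≠ 1) : code b ∈ delta3Codes (code a) := by
  rw [delta3Codes, List.mem_filter, Bool.not_eq_true', ← Bool.not_eq_true, Bool.or_eq_true,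
    Bool.or_eq_true, ← code_pow, ← code_mul, ← code_mul]
  have h20 {w : S₆} : powEqOne 20 (code w) = true → w ^ 20 = 1 := pow_eq_one_of_powEqOne
  exact ⟨code_mem_evenCodes hb, fun hor => hor.elim (h ∘ h20) (Or.rec (hab ∘ h20) (hab2 ∘ h20))⟩

theorem delta3_of_conj_eq {y : Fin 9 → S₆} (hy : ∀ i, sign (y i) = 1) {r c : S₆}
    (hc : MulAut.conj c (y 0) = r) (hr : (delta3Codes (code r)).length < 8) :
    (∃ i, y i ^ 20 = 1) ∨
      ∃ i j, i < j ∧ (y i = y j ∨ (y i * y j) ^ 20 = 1 ∨ (y i * y j ^ 2) ^ 20 = 1) := by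
  by_contra! hcon
  obtain ⟨h1, h2⟩ := hcon
  have hmem (j : Fin 8) : code (MulAut.conj c (y j.succ)) ∈ delta3Codes (code r) := by
    obtain ⟨-, hmul, hmul2⟩ := h2 0 j.succ j.succ_pos
    subst hc
    apply code_mem_delta3Codes (sign_conj (hy _) c) <;>
      simp only [← map_mul, ← map_pow, ne_eq, EmbeddingLike.map_eq_one_iff]
    exacts [h1 _, hmul, hmul2]
  obtain ⟨i, -, j, -, hij, heq⟩ := Finset.exists_ne_map_eq_of_card_lt_of_maps_to
    (s := Finset.univ) (t := (delta3Codes (code r)).toFinset)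
    (by simpa using (List.toFinset_card_le _).trans_lt hr)
    (fun j _ => List.mem_toFinset.2 (hmem j))
  have heq' : y i.succ = y j.succ := (MulAut.conj c).injective (code_injective heq)
  rcases lt_or_gt_of_ne hij with hlt | hlt
  · exact (h2 i.succ j.succ (Fin.succ_lt_succ_iff.2 hlt)).1 heq'
  · exact (h2 j.succ i.succ (Fin.succ_lt_succ_iff.2 hlt)).1 heq'.symm

theorem delta3_perm {y : Fin 9 → S₆} (hy : ∀ i, sign (y i) = 1) :
    (∃ i, y i ^ 20 = 1) ∨
      ∃ i j, i < j ∧ (y i = y j ∨ (y i * y j) ^ 20 = 1 ∨ (y i * y j ^ 2) ^ 20 = 1) := by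
  by_cases h : y 0 ^ 20 = 1
  · exact Or.inl ⟨0, h⟩
  rcases cycleType_of_pow_twenty_ne_one (hy 0) h with h | h
  · obtain ⟨c, hc⟩ := exists_conj_eq (h.trans cycleType_three.symm)
    exact delta3_of_conj_eq hy hc (by rw [code_three]; decide +kernel)
  · obtain ⟨c, hc⟩ := exists_conj_eq (h.trans cycleType_threeThree.symm)
    exact delta3_of_conj_eq hy hc (by rw [code_threeThree]; decide +kernel)

end Delta3

section Delta5

/-- For codes of even permutations, whether all of `uv`, `uv²`, `uv³` have even order. -/
def evenProducts (u v : ℕ) : Bool :=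
  !(powEqOne 15 (mul u v) || (powEqOne 15 (mul u (pow v 2)) || powEqOne 15 (mul u (pow v 3))))

theorem evenProducts_code {u v : S₆} (h : ¬ ((u * v) ^ 15 = 1 ∨ (u * v ^ 2) ^ 15 = 1 ∨
    (u * v ^ 3) ^ 15 = 1)) : evenProducts (code u) (code v) = true := by
  rw [evenProducts, Bool.not_eq_true', ← Bool.not_eq_true, Bool.or_eq_true, Bool.or_eq_true]
  simp only [← code_pow, ← code_mul]
  have h15 {w : S₆} : powEqOne 15 (code w) = true → w ^ 15 = 1 := pow_eq_one_of_powEqOne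
  exact mt (Or.imp h15 (Or.imp h15 h15)) h

/-- The formula `u ∈ ⟨v⟩` for codes. -/
def inCycCode (u v : ℕ) : Bool :=
  isId u || (Nat.beq u v || (Nat.beq u (pow v 2) || Nat.beq u (pow v 3)))

theorem inCycCode_code {u v : S₆} : inCycCode (code u) (code v) = true ↔ InCyc u v := by
  simp only [inCycCode, ← code_pow, Bool.or_eq_true, isId_code, beq_code, InCyc]

/-- The second and third parts of the formula `θ(u, v, w)` for codes, without those members of the
disjunction that the search does not need. -/
def thetaCode (u v w : ℕ) : Bool :=
  inCycCode u (mul v w) || (inCycCode v (mul u w) || (inCycCode w (mul u v) ||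
    (inCycCode (mul u v) (mul v w) || (inCycCode (mul v w) (mul w u) ||
      inCycCode (mul v u) (mul u w)))))

theorem theta_of_thetaCode {y : Fin 3 → S₆}
    (h : thetaCode (code (y 0)) (code (y 1)) (code (y 2)) = true) : Theta y := by
  simp only [thetaCode, ← code_mul, Bool.or_eq_true, inCycCode_code] at h
  rcases h with h | h | h | h | h | h
  · exact .inr (.inl ⟨1, h⟩)
  · exact .inr (.inl ⟨c[0, 1], h⟩)
  · exact .inr (.inl ⟨c[0, 2, 1], h⟩)
  · exact .inr (.inr ⟨1, h⟩)
  · exact .inr (.inr ⟨c[0, 1, 2], h⟩)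
  · exact .inr (.inr ⟨c[0, 1], h⟩)

theorem theta_map_iff {G H : Type*} [Group G] [Group H] (e : G ≃* H) {y : Fin 3 → G} :
    Theta (fun i => e (y i)) ↔ Theta y := by
  simp only [Theta, InCyc, ← map_mul, ← map_pow, EmbeddingLike.map_eq_one_iff,
    EmbeddingLike.apply_eq_iff_eq]

/-- The codes of the even permutations `b` of even order such that all of `rb, rb², rb³` and
`br, br², br³` have even order, where `r` is given by its code. -/
def delta5Codes (r : ℕ) : List ℕ :=
  evenCodes.filter fun b => !powEqOne 15 b && (evenProducts r b && evenProducts b r)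

/-- The formula `δ₅` for all triples whose first member has code `r`. -/
def delta5Code (r : ℕ) : Bool :=
  (delta5Codes r).all fun u => (delta5Codes r).all fun v =>
    !(evenProducts u v && evenProducts v u) || thetaCode r u v

theorem theta_of_conj_eq {y : Fin 3 → S₆} (hy : ∀ i, sign (y i) = 1) {r c : S₆}
    (hc : MulAut.conj c (y 0) = r) (h1 : ∀ i, y i ^ 15 ≠ 1)
    (h2 : ∀ i j, i ≠ j → ¬ ((y i * y j) ^ 15 = 1 ∨ (y i * y j ^ 2) ^ 15 = 1 ∨
      (y i * y j ^ 3) ^ 15 = 1)) (hr : delta5Code (code r) = true) : Theta y := by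
  subst hc
  let z (i : Fin 3) : S₆ := MulAut.conj c (y i)
  have hev {i j : Fin 3} (hij : i ≠ j) : evenProducts (code (z i)) (code (z j)) = true :=
    evenProducts_code (by
      simpa only [z, ← map_mul, ← map_pow, EmbeddingLike.map_eq_one_iff] using h2 i j hij)
  have hmem {i : Fin 3} (hi : i ≠ 0) : code (z i) ∈ delta5Codes (code (z 0)) := by
    have h15 : powEqOne 15 (code (z i)) = false := Bool.eq_false_iff.2 fun h => h1 i <| by
      simpa only [z, ← map_pow, EmbeddingLike.map_eq_one_iff] using pow_eq_one_of_powEqOne h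
    rw [delta5Codes, List.mem_filter, h15, hev hi, hev hi.symm]
    exact ⟨code_mem_evenCodes (sign_conj (hy i) c), rfl⟩
  have hθ := List.all_eq_true.1 (List.all_eq_true.1 hr _ (hmem (i := 1) (by decide))) _
    (hmem (i := 2) (by decide))
  rw [hev (by decide), hev (by decide), Bool.and_true, Bool.not_true, Bool.false_or] at hθ
  exact (theta_map_iff (MulAut.conj c)).1 (theta_of_thetaCode hθ)

theorem delta5_perm {y : Fin 3 → S₆} (hy : ∀ i, sign (y i) = 1) :
    Theta y ∨ (∃ i, y i ^ 15 = 1) ∨ ∃ i j, i ≠ j ∧ ((y i * y j) ^ 15 = 1 ∨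
      (y i * y j ^ 2) ^ 15 = 1 ∨ (y i * y j ^ 3) ^ 15 = 1) := by
  refine or_iff_not_imp_right.2 fun hcon => ?_
  push Not at hcon
  obtain ⟨h1, h2⟩ := hcon
  have h2 (i j : Fin 3) (hij : i ≠ j) : ¬ ((y i * y j) ^ 15 = 1 ∨ (y i * y j ^ 2) ^ 15 = 1 ∨
      (y i * y j ^ 3) ^ 15 = 1) := by
    push Not
    exact h2 i j hij
  rcases cycleType_of_pow_fifteen_ne_one (hy 0) (h1 0) with h | h
  · obtain ⟨c, hc⟩ := exists_conj_eq (h.trans cycleType_twoTwo.symm)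
    exact theta_of_conj_eq hy hc h1 h2 (by rw [code_twoTwo]; decide +kernel)
  · obtain ⟨c, hc⟩ := exists_conj_eq (h.trans cycleType_fourTwo.symm)
    exact theta_of_conj_eq hy hc h1 h2 (by rw [code_fourTwo]; decide +kernel)

end Delta5

end SixPoints

theorem card_alternatingGroup_six : Nat.card A₆ = 360 := by
  have := two_mul_nat_card_alternatingGroup (α := Fin 6)
  rw [Nat.card_perm, Nat.card_fin, show Nat.factorial 6 = 720 from rfl] at this
  omega

theorem satisfies_alternatingGroup_six : Satisfies A₆ sevenFormulas := by
  have hs (a : A₆) : Equiv.Perm.sign (a : S₆) = 1 := Equiv.Perm.mem_alternatingGroup.1 a.2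
  have heq (a b : A₆) : a = b ↔ (a : S₆) = b := SetLike.coe_eq_coe.symm
  rw [satisfies_sevenFormulas_iff]
  refine ⟨omega_holdsIn_of_card_le card_alternatingGroup_six.le, delta2_holdsIn_iff.2 fun a => ?_,
    delta3_holdsIn_iff.2 fun g => ?_, delta4_holdsIn_iff.2 fun a b => ?_,
    delta5_holdsIn_iff.2 fun y => ?_, delta6_holdsIn_iff.2 fun a b => ?_,
    delta7_holdsIn_iff.2 fun a b => ?_⟩
  · simpa only [heq] using! SixPoints.pow_cases (hs a)
  · simpa only [heq] using! SixPoints.delta3_perm fun i => hs (g i)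
  · simpa only [heq] using! SixPoints.delta4_perm (hs a) (hs b)
  · simpa only [Theta, InCyc, heq] using! SixPoints.delta5_perm fun i => hs (y i)
  · simpa only [heq] using! SixPoints.delta6_perm (hs a) (hs b)
  · simpa only [heq] using! SixPoints.delta7_perm (hs a) (hs b)

section Classification

variable {G : Type u} [Group G] {H : Type v} [Group H]

theorem Satisfies.nonempty_mulEquiv_of_card_eq (hG : Satisfies G sevenFormulas)
    (hH : Satisfies H sevenFormulas) (hcG : Nat.card G = 360) (hcH : Nat.card H = 360) :
    Nonempty (G ≃* H) := by
  obtain ⟨ψ, hψ, hr⟩ := hG.exists_injective_range_eq hcG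
  obtain ⟨ψ', hψ', hr'⟩ := hH.exists_injective_range_eq hcH
  exact ⟨((MonoidHom.ofInjective hψ).trans (MulEquiv.subgroupCongr (hr.trans hr'.symm))).trans
    (MonoidHom.ofInjective hψ').symm⟩

theorem Satisfies.isSection (hG : Satisfies G sevenFormulas) : IsSection G A₆ := by
  by_cases h : Nat.card G = 360
  · obtain ⟨e⟩ :=
      hG.nonempty_mulEquiv_of_card_eq satisfies_alternatingGroup_six h card_alternatingGroup_six
    exact isSection_of_injective (φ := e.toMonoidHom) e.injective
  · exact hG.isSection_of_card_ne h

end Classification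

theorem theorem3 :
    IsDBasis.{u} sevenFormulas (alternatingGroup (Fin 6)) ∧
    ∀ (G : Type u) [Group G], Satisfies G sevenFormulas →
      IsSection G (alternatingGroup (Fin 6)) :=
  ⟨⟨satisfies_alternatingGroup_six, fun _ _ hG => hG.isSection.inDVar⟩, fun _ _ hG => hG.isSection⟩
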